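/- **Conventions.** A composition $\alpha=(\alpha_1,\dots,\alpha_k)$ of $n=|\alpha|$ is a finite list of positive integers with sum $n$. Its diagram has $\alpha_i$ left-justified cells in row $i$ from the top, and $(i,j)$ is the cell in row $i$ and column $j$. For $S=\{i_1<\dots<i_k\}\subseteq[n-1]$ let $\mathrm{comp}(S)=(i_1,i_2-i_1,\dots,n-i_k)$, and let $\mathrm{set}$ be the inverse bijection. The order $<_c$ on compositions is generated by the covers: $\alpha$ is covered by $(1,\alpha_1,\dots,\alpha_k)$, and by $(\alpha_1,\dots,\alpha_j+1,\dots,\alpha_k)$ whenever $\alpha_i\ne\alpha_j$ for all $i<j$. **Tableaux.** For $\beta<_c\alpha$, let $\alpha/\!\!/\beta$ be the set of cells of $\alpha$ that are not in $\beta$, where $\beta$ is drawn in the bottom left corner of $\alpha$; its size is $m=|\alpha|-|\beta|$. A skew SRCT of shape $\alpha/\!\!/\beta$ is a bijection $\tau:\alpha/\!\!/\beta\to\{1,\dots,m\}$ whose entries decrease from left to right along rows, increase from top to bottom in the first column, and satisfy, with $\tau=\infty$ on $\beta$: if $i<j$, $(j,k+1)\in\alpha/\!\!/\beta$ and $\tau(i,k)>\tau(j,k+1)$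 (where $(i,k)$ is a cell of $\alpha$), then $(i,k+1)$ is a cell of $\alpha$ and $\tau(i,k+1)>\tau(j,k+1)$. Write $\mathrm{SRCT}(\alpha/\!\!/\beta)$ for the set of these. The descent set $\mathrm{des}(\tau)\subseteq[m-1]$ consists of the $i$ such that $i+1$ appears weakly right of $i$, and $\mathrm{comp}(\tau)=\mathrm{comp}(\mathrm{des}(\tau))$. The entries $i,i+1$ are attacking if they are in the same column, or if they are in adjacent columns with $i+1$ strictly southeast of $i$. For $1\le i\le m-1$ put $$\pi_i(\tau)=\begin{cases}\tau & i\notin\mathrm{des}(\tau),\\ 0 & i\in\mathrm{des}(\tau),\ i,i+1\text{ attacking},\\ s_i(\tau) & i\in\mathrm{des}(\tau),\ i,i+1\text{ not attacking},\end{cases}$$ where $s_i(\tau)$ is obtained from $\tau$ by interchanging the entries $i$ and $i+1$. Extend $\pi_i$ linearly. Write $\tau\preccurlyeq\tau'$ if there is $\sigma\in\mathfrak S_m$ with $\pi_\sigma(\tau)=\tau'$, where $\pi_\sigma=\pi_{i_1}\cdots\pi_{i_p}$ for a reduced word $s_{i_1}\cdots s_{i_p}$ of $\sigma$. **Characteristic.**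 $H_n(0)$ is the $\mathbb C$-algebra generated by $T_1,\dots,T_{n-1}$ with relations $T_i^2=T_i$, $T_iT_{i+1}T_i=T_{i+1}T_iT_{i+1}$, and $T_iT_j=T_jT_i$ for $|i-j|\ge2$. Let $\mathcal G_0(H_n(0))$ be the Grothendieck group of its finite dimensional modules with respect to short exact sequences, and $\mathcal G=\bigoplus_{n\ge0}\mathcal G_0(H_n(0))$. For a composition $\alpha$ of $n$ let $\mathbf F_\alpha$ be the one-dimensional module on which $T_i$ acts by $0$ if $i\in\mathrm{set}(\alpha)$ and by $1$ otherwise, and let $F_\alpha=\sum x_{i_1}\cdots x_{i_n}$ over all $1\le i_1\le\dots\le i_n$ with $i_j<i_{j+1}$ for $j\in\mathrm{set}(\alpha)$ be the fundamental quasisymmetric function. The quasisymmetric characteristic $ch:\mathcal G\to\mathrm{QSym}=\mathrm{span}_{\mathbb C}\{F_\alpha\}$ is the linear map with $ch([\mathbf F_\alpha])=F_\alpha$ for all $\alpha$. The skew quasisymmetric Schur function is $$\mathcal S_{\alpha/\!\!/\beta}=\sum_{\tau\in\mathrm{SRCT}(\alpha/\!\!/\beta)}F_{\mathrm{comp}(\tau)}.$$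 **Theorem.** Let $\alpha,\beta$ be compositions with $\beta<_c\alpha$ and $|\alpha/\!\!/\beta|=m$. Then $\mathrm{SRCT}(\alpha/\!\!/\beta)$ is nonempty and $\preccurlyeq$ is a partial order on it. Let $\preccurlyeq^t$ be any total order on $\mathrm{SRCT}(\alpha/\!\!/\beta)$ extending $\preccurlyeq$, let $\tau_1$ be its minimal element, and let $\mathcal V_{\tau_1}=\mathrm{span}_{\mathbb C}\{\tau\in\mathrm{SRCT}(\alpha/\!\!/\beta)\mid\tau_1\preccurlyeq^t\tau\}$. Then $\mathcal V_{\tau_1}$ is an $H_m(0)$-module, with $T_i$ acting as $\pi_i$ for $1\le i\le m-1$, and its quasisymmetric characteristic is $ch([\mathcal V_{\tau_1}])=\mathcal S_{\alpha/\!\!/\beta}$. -/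

import Mathlib

section

/-! ### Compositions and the reverse composition poset -/

/-- The natural bijection between compositions of `n` and subsets of `[n-1]`,
`(α₁, …, α_k) ↦ {α₁, α₁ + α₂, …, α₁ + ⋯ + α_{k-1}}`.
An element `i : Fin (n - 1)` stands for the number `i + 1 ∈ [n-1]`. -/
def compSetEquiv (n : ℕ) : Composition n ≃ Finset (Fin (n - 1)) :=
  (compositionEquiv n).trans (compositionAsSetEquiv n)

/-- The cover relation of the reverse composition poset, on lists of parts. -/
inductive RCCovers : List ℕ → List ℕ → Prop
  /-- prefix a part of size `1` -/
  | prefix (α : List ℕ) : RCCovers α (1 :: α)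
  /-- add `1` to a part that is the leftmost part of its size -/
  | add (l : List ℕ) (k : ℕ) (r : List ℕ) (h : k ∉ l) : RCCovers (l ++ k :: r) (l ++ (k + 1) :: r)

/-- The strict order `β <_c α` of the reverse composition poset. -/
def RCLT {b a : ℕ} (β : Composition b) (α : Composition a) : Prop :=
  Relation.TransGen RCCovers β.blocks α.blocks

/-! ### Skew shapes and skew standard reverse composition tableaux

Rows and columns are numbered from `0`, rows from the top and columns from the left. -/

/-- The number of cells in row `i` of the outer shape `α`. -/
def outerLen {a : ℕ} (α : Composition a) (i : ℕ) : ℕ := α.blocks.getD i 0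

/-- The number of cells of the inner shape `β` in row `i` of `α`, where `β` is drawn in the
bottom left corner of `α`. -/
def innerLen {a b : ℕ} (α : Composition a) (β : Composition b) (i : ℕ) : ℕ :=
  if i + β.length < α.length then 0 else β.blocks.getD (i + β.length - α.length) 0

/-- The cells `(i, j)` of the skew reverse composition shape `α // β`. -/
def skewCells {a b : ℕ} (α : Composition a) (β : Composition b) : Finset (ℕ × ℕ) :=
  (Finset.range α.length ×ˢ Finset.range a).filter
    fun c => innerLen α β c.1 ≤ c.2 ∧ c.2 < outerLen α c.1

/-- Bijective fillings of the cells of `α // β`. The element `x : Fin m` stands for the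
entry `x + 1 ∈ {1, …, m}`. -/
abbrev SkewFilling {a b : ℕ} (α : Composition a) (β : Composition b) (m : ℕ) : Type :=
  skewCells α β ≃ Fin m

namespace SkewFilling

variable {a b m : ℕ} {α : Composition a} {β : Composition b}

/-- The entry at a position `c`, extended by `∞` on the inner shape, and by `0` (which is smaller
than all entries) at positions outside of the diagram of `α`. -/
noncomputable def entry (τ : SkewFilling α β m) (c : ℕ × ℕ) : ℕ∞ :=
  if h : c ∈ skewCells α β then ((τ ⟨c, h⟩ : ℕ) + 1 : ℕ)
  else if c.2 < innerLen α β c.1 then ⊤ else 0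

/-- The conditions for a filling to be a skew standard reverse composition tableau. -/
structure IsSRCT (τ : SkewFilling α β m) : Prop where
  /-- entries decrease along rows -/
  row : ∀ c d : skewCells α β, c.1.1 = d.1.1 → c.1.2 < d.1.2 → τ d < τ c
  /-- entries in the first column increase from top to bottom -/
  col : ∀ c d : skewCells α β, c.1.2 = 0 → d.1.2 = 0 → c.1.1 < d.1.1 → τ c < τ d
  /-- the triple rule -/
  triple : ∀ i j k : ℕ, i < j → (j, k + 1) ∈ skewCells α β →
    τ.entry (j, k + 1) < τ.entry (i, k) → τ.entry (j, k + 1) < τ.entry (i, k + 1)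

/-- The element of `Fin m` standing for the entry `i`, when `i : Fin (m - 1)` stands for `i`. -/
def lo (i : Fin (m - 1)) : Fin m := ⟨i, by omega⟩

/-- The element of `Fin m` standing for the entry `i + 1`, when `i : Fin (m - 1)` stands
for `i`. -/
def hi (i : Fin (m - 1)) : Fin m := ⟨i + 1, by omega⟩

/-- The position `(row, column)` of an entry. -/
def pos (τ : SkewFilling α β m) (x : Fin m) : ℕ × ℕ := (τ.symm x).1

/-- The descent set: all `i` such that `i + 1` appears weakly right of `i`. -/
def descents (τ : SkewFilling α β m) : Finset (Fin (m - 1)) :=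
  Finset.univ.filter fun i => (τ.pos (lo i)).2 ≤ (τ.pos (hi i)).2

/-- The descent composition. -/
def descentComp (τ : SkewFilling α β m) : Composition m := (compSetEquiv m).symm τ.descents

/-- `i` and `i + 1` are attacking: they are in the same column, or in adjacent columns with
`i + 1` strictly southeast of `i`. -/
def Attacking (τ : SkewFilling α β m) (i : Fin (m - 1)) : Prop :=
  (τ.pos (lo i)).2 = (τ.pos (hi i)).2 ∨
    ((τ.pos (hi i)).2 = (τ.pos (lo i)).2 + 1 ∧ (τ.pos (lo i)).1 < (τ.pos (hi i)).1)

/-- `s_i(τ)`: interchange the positions of the entries `i` and `i + 1`. -/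
def swapEntries (τ : SkewFilling α β m) (i : Fin (m - 1)) : SkewFilling α β m :=
  Equiv.trans τ (Equiv.swap (lo i) (hi i))

end SkewFilling

/-- The set of skew standard reverse composition tableaux of shape `α // β` and size `m`. -/
abbrev SkewSRCT {a b : ℕ} (α : Composition a) (β : Composition b) (m : ℕ) : Type :=
  {τ : SkewFilling α β m // τ.IsSRCT}

open scoped Classical in
/-- The flip `π_i`, by the same formula on the vector space spanned by all bijective fillings. -/
noncomputable def skewFlip {a b : ℕ} (α : Composition a) (β : Composition b) {m : ℕ}
    (i : Fin (m - 1)) : Module.End ℂ (SkewFilling α β m →₀ ℂ) :=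
  Finsupp.linearCombination ℂ fun τ =>
    if i ∉ τ.descents then Finsupp.single τ 1
    else if τ.Attacking i then 0
    else Finsupp.single (τ.swapEntries i) 1

/-- The permutation `s_{i₁} ⋯ s_{i_p}` of a word in the adjacent transpositions. -/
def wordPerm {m : ℕ} (w : List (Fin (m - 1))) : Equiv.Perm (Fin m) :=
  (w.map fun i => Equiv.swap (SkewFilling.lo i) (SkewFilling.hi i)).prod

/-- `w` is a reduced word for `σ`. -/
def IsReducedWord {m : ℕ} (w : List (Fin (m - 1))) (σ : Equiv.Perm (Fin m)) : Prop :=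
  wordPerm w = σ ∧ ∀ w' : List (Fin (m - 1)), wordPerm w' = σ → w.length ≤ w'.length

/-- The relation `τ₁ ≼ τ₂` on skew tableaux: `π_σ(τ₁) = τ₂` for some permutation `σ`, where
`π_σ = π_{i₁} ⋯ π_{i_p}` for a reduced word `s_{i₁} ⋯ s_{i_p}` of `σ`. -/
def flipLE {a b : ℕ} {α : Composition a} {β : Composition b} {m : ℕ}
    (τ₁ τ₂ : SkewSRCT α β m) : Prop :=
  ∃ (σ : Equiv.Perm (Fin m)) (w : List (Fin (m - 1))), IsReducedWord w σ ∧
    (w.map (skewFlip α β)).prod (Finsupp.single τ₁.1 1) = Finsupp.single τ₂.1 1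

/-- The span `𝒱_τ` of all tableaux that are at least `τ` for the relation `le`. -/
noncomputable def upperSpan {a b : ℕ} {α : Composition a} {β : Composition b} {m : ℕ}
    (le : SkewSRCT α β m → SkewSRCT α β m → Prop) (τ : SkewSRCT α β m) :
    Submodule ℂ (SkewFilling α β m →₀ ℂ) :=
  Submodule.span ℂ {v | ∃ τ' : SkewSRCT α β m, le τ τ' ∧ v = Finsupp.single τ'.1 1}

/-! ### Quasisymmetric functions -/

/-- The fundamental quasisymmetric function `F_α` as a formal power series in variables indexed
by `ℕ`: the coefficient of a monomial is the number of sequences `i₁ ≤ ⋯ ≤ i_n` with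
`i_j < i_{j+1}` for `j ∈ set(α)` whose product `x_{i₁} ⋯ x_{i_n}` is that monomial. -/
noncomputable def fundamentalQS {n : ℕ} (α : Composition n) : MvPowerSeries ℕ ℂ :=
  fun d => (Set.ncard {f : Fin n → ℕ | Monotone f ∧
    (∀ j ∈ compSetEquiv n α, f (SkewFilling.lo j) < f (SkewFilling.hi j)) ∧
    ∑ j, Finsupp.single (f j) 1 = d} : ℂ)

/-- The space of quasisymmetric functions. -/
noncomputable def QSym : Submodule ℂ (MvPowerSeries ℕ ℂ) :=
  Submodule.span ℂ (Set.range fun α : (Σ n, Composition n) => fundamentalQS α.2)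

open scoped Classical in
/-- The skew quasisymmetric Schur function `𝒮_{α // β}`, where `α // β` has size `m`. -/
noncomputable def skewQuasiSchur {a b : ℕ} (α : Composition a) (β : Composition b) (m : ℕ) :
    MvPowerSeries ℕ ℂ :=
  ∑ τ : SkewSRCT α β m, fundamentalQS τ.1.descentComp

/-! ### The `0`-Hecke algebra, its representations, and the quasisymmetric characteristic -/

/-- The defining relations of the `0`-Hecke algebra; the generator `T_{i+1}` is indexed by
`i : Fin (n - 1)`. -/
inductive HeckeZeroRel (n : ℕ) :
    FreeAlgebra ℂ (Fin (n - 1)) → FreeAlgebra ℂ (Fin (n - 1)) → Prop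
  | idem (i : Fin (n - 1)) : HeckeZeroRel n
      (FreeAlgebra.ι ℂ i * FreeAlgebra.ι ℂ i) (FreeAlgebra.ι ℂ i)
  | braid (i j : Fin (n - 1)) (h : (i : ℕ) + 1 = j) : HeckeZeroRel n
      (FreeAlgebra.ι ℂ i * FreeAlgebra.ι ℂ j * FreeAlgebra.ι ℂ i)
      (FreeAlgebra.ι ℂ j * FreeAlgebra.ι ℂ i * FreeAlgebra.ι ℂ j)
  | comm (i j : Fin (n - 1)) (h : (i : ℕ) + 2 ≤ j) : HeckeZeroRel n
      (FreeAlgebra.ι ℂ i * FreeAlgebra.ι ℂ j) (FreeAlgebra.ι ℂ j * FreeAlgebra.ι ℂ i)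

/-- The `0`-Hecke algebra `H_n(0)`. -/
abbrev HeckeZero (n : ℕ) : Type := RingQuot (HeckeZeroRel n)

/-- The generators of `H_n(0)`. -/
noncomputable def HeckeZero.T {n : ℕ} (i : Fin (n - 1)) : HeckeZero n :=
  RingQuot.mkAlgHom ℂ (HeckeZeroRel n) (FreeAlgebra.ι ℂ i)

/-- Finite dimensional representations (modules) of `H_n(0)`. -/
structure HeckeRep (n : ℕ) : Type 1 where
  /-- the underlying vector space -/
  carrier : Type
  [addCommGroup : AddCommGroup carrier]
  [module : Module ℂ carrier]
  [finite : FiniteDimensional ℂ carrier]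
  /-- the action -/
  ρ : HeckeZero n →ₐ[ℂ] Module.End ℂ carrier

attribute [instance] HeckeRep.addCommGroup HeckeRep.module HeckeRep.finite

/-- There is a short exact sequence `0 → M' → M → M'' → 0` of `H_n(0)`-modules. -/
def HeckeRep.IsExtension {n : ℕ} (M' M M'' : HeckeRep n) : Prop :=
  ∃ (f : M'.carrier →ₗ[ℂ] M.carrier) (g : M.carrier →ₗ[ℂ] M''.carrier),
    (∀ x v, f (M'.ρ x v) = M.ρ x (f v)) ∧ (∀ x v, g (M.ρ x v) = M''.ρ x (g v)) ∧
    Function.Injective f ∧ Function.Surjective g ∧ Function.Exact f g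

/-- The Grothendieck group `𝒢₀(H_n(0))`: generated by the finite dimensional modules, with
`[M] = [M'] + [M'']` for each short exact sequence (which identifies isomorphic modules). -/
abbrev HeckeG0 (n : ℕ) : Type 1 :=
  FreeAbelianGroup (HeckeRep n) ⧸ AddSubgroup.closure
    {x | ∃ M' M M'' : HeckeRep n, HeckeRep.IsExtension M' M M'' ∧
      x = FreeAbelianGroup.of M - (FreeAbelianGroup.of M' + FreeAbelianGroup.of M'')}

/-- The direct sum `𝒢` of all the groups `𝒢₀(H_n(0))`, `n ≥ 0`. -/
abbrev HeckeG : Type 1 := DirectSum ℕ HeckeG0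

/-- The class `[M] ∈ 𝒢` of a module. -/
noncomputable def HeckeRep.cls {n : ℕ} (M : HeckeRep n) : HeckeG :=
  DirectSum.of HeckeG0 n (QuotientAddGroup.mk (FreeAbelianGroup.of M))

open scoped Classical in
/-- The character of `H_n(0)` with `T_i ↦ 0` for `i ∈ J` and `T_i ↦ 1` for `i ∉ J`. -/
noncomputable def heckeChar {n : ℕ} (J : Finset (Fin (n - 1))) : HeckeZero n →ₐ[ℂ] ℂ :=
  RingQuot.liftAlgHom ℂ ⟨FreeAlgebra.lift ℂ fun i => if i ∈ J then 0 else 1, by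
    rintro _ _ (i | ⟨i, j, h⟩ | ⟨i, j, h⟩) <;> simp only [map_mul, FreeAlgebra.lift_ι_apply] <;>
    split_ifs <;> simp⟩

/-- The one-dimensional irreducible module `𝐅_α`. -/
noncomputable def irrRep {n : ℕ} (α : Composition n) : HeckeRep n where
  carrier := ℂ
  ρ := (Algebra.ofId ℂ (Module.End ℂ ℂ)).comp (heckeChar (compSetEquiv n α))

theorem heckeChar_T {n : ℕ} (J : Finset (Fin (n - 1))) (i : Fin (n - 1)) :
    heckeChar J (HeckeZero.T i) = if i ∈ J then 0 else 1 := by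
  simp [heckeChar, HeckeZero.T]

theorem irrRep_apply {n : ℕ} (α : Composition n) (x : HeckeZero n) (v : ℂ) :
    (irrRep α).ρ x v = heckeChar (compSetEquiv n α) x * v := by
  rfl

theorem irrRep_trace {n : ℕ} (α : Composition n) (x : HeckeZero n) :
    LinearMap.trace ℂ _ ((irrRep α).ρ x) = heckeChar (compSetEquiv n α) x := by
  have h : LinearMap.trace ℂ ℂ (heckeChar (compSetEquiv n α) x • LinearMap.id) =
      heckeChar (compSetEquiv n α) x := by
    rw [map_smul, LinearMap.trace_id]
    simp
  exact h

/-- Traces are additive on short exact sequences. -/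
theorem HeckeRep.IsExtension.trace {n : ℕ} {M' M M'' : HeckeRep n}
    (h : HeckeRep.IsExtension M' M M'') (x : HeckeZero n) :
    LinearMap.trace ℂ _ (M.ρ x) =
      LinearMap.trace ℂ _ (M'.ρ x) + LinearMap.trace ℂ _ (M''.ρ x) := by
  obtain ⟨f, g, hf, hg, fi, gs, ex⟩ := h
  obtain ⟨s, hs⟩ := g.exists_rightInverse_of_surjective (LinearMap.range_eq_top.2 gs)
  have hs' : ∀ v, g (s v) = v := fun v => LinearMap.congr_fun hs v
  have hmem : ∀ v, v - s (g v) ∈ LinearMap.range f := fun v =>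
    (ex _).1 (by rw [map_sub, hs', sub_self])
  let r : M.carrier →ₗ[ℂ] M'.carrier := (LinearEquiv.ofInjective f fi).symm.toLinearMap ∘ₗ
    LinearMap.codRestrict (LinearMap.range f) (LinearMap.id - s ∘ₗ g) hmem
  have hr : ∀ v, f (r v) = v - s (g v) := fun v => by
    have := LinearEquiv.apply_symm_apply (LinearEquiv.ofInjective f fi) ⟨_, hmem v⟩
    exact congrArg Subtype.val this
  have hrf : ∀ v, r (f v) = v := fun v => fi (by
    rw [hr, (ex (f v)).2 ⟨v, rfl⟩, map_zero, sub_zero])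
  have e : M.ρ x = (M.ρ x ∘ₗ f) ∘ₗ r + (M.ρ x ∘ₗ s) ∘ₗ g := by
    ext v
    simp [hr]
  have e1 : r ∘ₗ (M.ρ x ∘ₗ f) = M'.ρ x := by
    ext v
    simp [← hf, hrf]
  have e2 : g ∘ₗ (M.ρ x ∘ₗ s) = M''.ρ x := by
    ext v
    simp [hg, hs']
  rw [← e1, ← e2, LinearMap.trace_comp_comm' (M.ρ x ∘ₗ f) r,
    LinearMap.trace_comp_comm' (M.ρ x ∘ₗ s) g, ← map_add, ← e]

open scoped Classical in
/-- An element of `H_n(0)` on which `heckeChar J` is `1` and the other `heckeChar J'` are `0`. -/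
noncomputable def heckeProj {n : ℕ} (J : Finset (Fin (n - 1))) : HeckeZero n :=
  ((List.finRange (n - 1)).map fun i => if i ∈ J then 1 - HeckeZero.T i else HeckeZero.T i).prod

theorem heckeChar_heckeProj {n : ℕ} (J J' : Finset (Fin (n - 1))) :
    heckeChar J' (heckeProj J) = if J = J' then 1 else 0 := by
  classical
  rw [heckeProj, map_list_prod, List.map_map]
  split_ifs with h
  · subst h
    refine List.prod_eq_one fun y hy => ?_
    obtain ⟨i, -, rfl⟩ := List.mem_map.1 hy
    by_cases hi : i ∈ J <;> simp [hi, heckeChar_T]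
  · rw [List.prod_eq_zero_iff, List.mem_map]
    obtain ⟨i, hi⟩ : ∃ i, ¬ (i ∈ J ↔ i ∈ J') := by
      by_contra hc
      push Not at hc
      exact h (Finset.ext hc)
    refine ⟨i, List.mem_finRange i, ?_⟩
    by_cases h1 : i ∈ J <;> by_cases h2 : i ∈ J' <;> simp_all [heckeChar_T]

/-- `F_α` as an element of the space of quasisymmetric functions. -/
noncomputable def fundamentalQSym {n : ℕ} (α : Composition n) : QSym :=
  ⟨fundamentalQS α, Submodule.subset_span ⟨⟨n, α⟩, rfl⟩⟩

theorem exists_quasiChar : ∃ ch : HeckeG →+ QSym,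
    ∀ (n : ℕ) (α : Composition n), ch (irrRep α).cls = fundamentalQSym α := by
  let c : ∀ n, HeckeG0 n →+ QSym := fun n => QuotientAddGroup.lift _
    (FreeAbelianGroup.lift fun M => ∑ α : Composition n,
      LinearMap.trace ℂ _ (M.ρ (heckeProj (compSetEquiv n α))) • fundamentalQSym α) (by
    rw [AddSubgroup.closure_le]
    rintro _ ⟨M', M, M'', h, rfl⟩
    simp [AddMonoidHom.mem_ker, h.trace, add_smul, Finset.sum_add_distrib])
  refine ⟨DirectSum.toAddMonoid c, fun n α => ?_⟩
  have key : ∀ γ : Composition n, LinearMap.trace ℂ _ ((irrRep α).ρ (heckeProj (compSetEquiv n γ)))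
      = if γ = α then 1 else 0 := fun γ => by
    rw [irrRep_trace, heckeChar_heckeProj]
    simp
  rw [HeckeRep.cls, DirectSum.toAddMonoid_of]
  simp [c, key]

/-- Operators satisfying the relations of the `0`-Hecke algebra have a common eigenvector. -/
theorem exists_common_eigenvector {V : Type} [AddCommGroup V] [Module ℂ V] [Nontrivial V]
    (p : ℕ → Module.End ℂ V) (hid : ∀ i v, p i (p i v) = p i v)
    (hbr : ∀ i v, p i (p (i + 1) (p i v)) = p (i + 1) (p i (p (i + 1) v)))
    (hco : ∀ i j v, i + 2 ≤ j → p i (p j v) = p j (p i v)) (N : ℕ) :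
    ∃ u : V, u ≠ 0 ∧ ∀ i < N, ∃ ε : ℂ, p i u = ε • u := by
  induction N with
  | zero =>
    obtain ⟨u, hu⟩ := exists_ne (0 : V)
    exact ⟨u, hu, by simp⟩
  | succ N ih =>
    obtain ⟨u, hu, hε⟩ := ih
    let w : ℕ → V := fun d => Nat.rec u (fun d v => p (N - d) v) d
    have w0 : w 0 = u := rfl
    have ws : ∀ d, w (d + 1) = p (N - d) (w d) := fun d => rfl
    have low : ∀ (i : ℕ) (ε : ℂ), p i u = ε • u → ∀ d, i + d < N → p i (w d) = ε • w d := by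
      intro i ε h d
      induction d with
      | zero => intro _; exact h
      | succ d ihd =>
        intro hd
        rw [ws, hco i (N - d) _ (by omega), ihd (by omega), map_smul]
    have high : ∀ (i : ℕ) (ε : ℂ), p i u = ε • u → ∀ d, d ≤ N + 1 → i < N → N + 1 ≤ i + d →
        p (i + 1) (w d) = ε • w d := by
      intro i ε h d
      induction d with
      | zero => intro _ h1 h2; omega
      | succ d ihd =>
        intro h0 h1 h2
        by_cases h3 : N + 1 ≤ i + d
        · rw [ws, ← hco (N - d) (i + 1) _ (by omega), ihd (by omega) h1 h3, map_smul]
        · obtain ⟨e, rfl⟩ : ∃ e, d = e + 1 := ⟨d - 1, by omega⟩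
          have a1 : N - e = i + 1 := by omega
          have a2 : N - (e + 1) = i := by omega
          rw [ws, ws, a1, a2, ← hbr, low i ε h e (by omega), map_smul, map_smul]
    have fin : ∀ d, d ≤ N + 1 → w d ≠ 0 → (d ≤ N → w (d + 1) = 0) →
        ∃ u : V, u ≠ 0 ∧ ∀ i < N + 1, ∃ ε : ℂ, p i u = ε • u := by
      intro d hd h1 h2
      refine ⟨w d, h1, fun i hi => ?_⟩
      rcases lt_trichotomy (i + d) N with h | h | h
      · obtain ⟨ε, he⟩ := hε i (by omega)
        exact ⟨ε, low i ε he d h⟩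
      · refine ⟨0, ?_⟩
        have := h2 (by omega)
        rw [ws, show N - d = i by omega] at this
        rw [this, zero_smul]
      · by_cases h' : i + d = N + 1
        · obtain ⟨e, rfl⟩ : ∃ e, d = e + 1 := ⟨d - 1, by omega⟩
          refine ⟨1, ?_⟩
          rw [ws, show N - e = i by omega, hid, one_smul]
        · obtain ⟨j, rfl⟩ : ∃ j, i = j + 1 := ⟨i - 1, by omega⟩
          obtain ⟨ε, he⟩ := hε j (by omega)
          exact ⟨ε, high j ε he d hd (by omega) (by omega)⟩
    have step : ∀ d, d ≤ N + 1 → w d ≠ 0 ∨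
        ∃ u : V, u ≠ 0 ∧ ∀ i < N + 1, ∃ ε : ℂ, p i u = ε • u := by
      intro d
      induction d with
      | zero => exact fun _ => Or.inl hu
      | succ d ihd =>
        intro hd
        rcases ihd (by omega) with h | h
        · by_cases h' : w (d + 1) = 0
          · exact Or.inr (fin d (by omega) h fun _ => h')
          · exact Or.inl h'
        · exact Or.inr h
    rcases step (N + 1) le_rfl with h | h
    · exact fin (N + 1) le_rfl h fun h => by omega
    · exact h

theorem HeckeZero.T_idem {n : ℕ} (i : Fin (n - 1)) : (T i * T i : HeckeZero n) = T i := by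
  simp only [T, ← map_mul]
  exact RingQuot.mkAlgHom_rel ℂ (HeckeZeroRel.idem i)

theorem HeckeZero.T_braid {n : ℕ} (i j : Fin (n - 1)) (h : (i : ℕ) + 1 = j) :
    (T i * T j * T i : HeckeZero n) = T j * T i * T j := by
  simp only [T, ← map_mul]
  exact RingQuot.mkAlgHom_rel ℂ (HeckeZeroRel.braid i j h)

theorem HeckeZero.T_comm {n : ℕ} (i j : Fin (n - 1)) (h : (i : ℕ) + 2 ≤ j) :
    (T i * T j : HeckeZero n) = T j * T i := by
  simp only [T, ← map_mul]
  exact RingQuot.mkAlgHom_rel ℂ (HeckeZeroRel.comm i j h)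

theorem HeckeZero.induction {n : ℕ} {C : HeckeZero n → Prop} (h1 : ∀ c : ℂ, C (algebraMap ℂ _ c))
    (h2 : ∀ i, C (T i)) (h3 : ∀ x y, C x → C y → C (x * y)) (h4 : ∀ x y, C x → C y → C (x + y))
    (x : HeckeZero n) : C x := by
  obtain ⟨y, rfl⟩ := RingQuot.mkAlgHom_surjective ℂ (HeckeZeroRel n) x
  induction y using FreeAlgebra.induction with
  | grade0 r => simpa using h1 r
  | grade1 i => exact h2 i
  | mul a b ha hb => rw [map_mul]; exact h3 _ _ ha hb
  | add a b ha hb => rw [map_add]; exact h4 _ _ ha hb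

/-- Every nonzero module contains one of the modules `𝐅_α`. -/
theorem HeckeRep.exists_char {n : ℕ} (M : HeckeRep n) [Nontrivial M.carrier] :
    ∃ (u : M.carrier) (α : Composition n), u ≠ 0 ∧
      ∀ x, M.ρ x u = heckeChar (compSetEquiv n α) x • u := by
  classical
  let p : ℕ → Module.End ℂ M.carrier := fun i =>
    if h : i < n - 1 then M.ρ (HeckeZero.T ⟨i, h⟩) else 0
  have pT : ∀ i : Fin (n - 1), p i = M.ρ (HeckeZero.T i) := fun i => by simp [p]
  obtain ⟨u, hu, hε⟩ := exists_common_eigenvector p (fun i v => by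
      by_cases h : i < n - 1
      · simp only [p, h, dite_true]
        rw [← Module.End.mul_apply, ← map_mul, HeckeZero.T_idem]
      · simp [p, h]) (fun i v => by
      by_cases h : i + 1 < n - 1
      · have h' : i < n - 1 := by omega
        simp only [p, h, h', dite_true]
        simp only [← Module.End.mul_apply, ← map_mul]
        rw [← mul_assoc, ← mul_assoc, HeckeZero.T_braid _ _ rfl]
      · simp [p, h]) (fun i j v hij => by
      by_cases h : j < n - 1
      · have h' : i < n - 1 := by omega
        simp only [p, h, h', dite_true]
        simp only [← Module.End.mul_apply, ← map_mul]
        rw [HeckeZero.T_comm _ _ hij]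
      · simp [p, h]) (n - 1)
  let J : Finset (Fin (n - 1)) := Finset.univ.filter fun i => M.ρ (HeckeZero.T i) u = 0
  refine ⟨u, (compSetEquiv n).symm J, hu, fun x => ?_⟩
  rw [Equiv.apply_symm_apply]
  induction x using HeckeZero.induction with
  | h1 c => simp [Algebra.algebraMap_eq_smul_one]
  | h2 i =>
    rw [heckeChar_T]
    by_cases h : M.ρ (HeckeZero.T i) u = 0
    · simp [J, h]
    · obtain ⟨ε, he⟩ := hε i i.2
      rw [pT] at he
      have h2 : M.ρ (HeckeZero.T i) (M.ρ (HeckeZero.T i) u) = M.ρ (HeckeZero.T i) u := by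
        rw [← Module.End.mul_apply, ← map_mul, HeckeZero.T_idem]
      rw [he, map_smul, he, smul_smul] at h2
      have h3 : ε * ε = ε := smul_left_injective ℂ hu h2
      have h4 : ε ≠ 0 := fun h5 => h (by rw [he, h5, zero_smul])
      have h5 : ε = 1 := mul_left_cancel₀ h4 (by rw [h3, mul_one])
      simp [J, he, h5, hu]
  | h3 x y hx hy => rw [map_mul, Module.End.mul_apply, hy, map_smul, hx, map_mul, smul_smul, mul_comm]
  | h4 x y hx hy => rw [map_add, LinearMap.add_apply, hx, hy, map_add, add_smul]

theorem HeckeRep.IsExtension.cls {n : ℕ} {M' M M'' : HeckeRep n}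
    (h : HeckeRep.IsExtension M' M M'') : M.cls = M'.cls + M''.cls := by
  simp only [HeckeRep.cls, ← map_add, ← QuotientAddGroup.mk_add]
  congr 1
  refine (QuotientAddGroup.eq_iff_sub_mem).2 (AddSubgroup.subset_closure ⟨_, _, _, h, rfl⟩)

/-- The quotient of a module by an invariant subspace. -/
noncomputable def HeckeRep.quotient {n : ℕ} (M : HeckeRep n) (W : Submodule ℂ M.carrier)
    (h : ∀ x, W ≤ W.comap (M.ρ x)) : HeckeRep n where
  carrier := M.carrier ⧸ W
  ρ := AlgHom.ofLinearMap
    { toFun := fun x => W.mapQ W (M.ρ x) (h x)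
      map_add' := fun x y => by ext; simp
      map_smul' := fun c x => by ext; simp }
    (by ext; simp) (fun x y => by ext; simp)

theorem HeckeRep.cls_mem_closure {n : ℕ} (M : HeckeRep n) :
    M.cls ∈ AddSubgroup.closure (Set.range fun α : Composition n => (irrRep α).cls) := by
  induction hd : Module.finrank ℂ M.carrier using Nat.strong_induction_on generalizing M with
  | _ d ih =>
    rcases subsingleton_or_nontrivial M.carrier with hs | hn
    · have h : HeckeRep.IsExtension M M M := by
        refine ⟨0, 0, by simp, by simp, fun _ _ _ => Subsingleton.elim _ _,
          fun v => ⟨0, Subsingleton.elim _ _⟩, fun v => ⟨fun _ => ⟨0, Subsingleton.elim _ _⟩,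
          fun _ => Subsingleton.elim _ _⟩⟩
      have := h.cls
      rw [left_eq_add] at this
      rw [this]
      exact zero_mem _
    · obtain ⟨u, α, hu, hx⟩ := M.exists_char
      have inv : ∀ x, Submodule.span ℂ {u} ≤ (Submodule.span ℂ {u}).comap (M.ρ x) := fun x => by
        rw [Submodule.span_singleton_le_iff_mem, Submodule.mem_comap, hx]
        exact Submodule.smul_mem _ _ (Submodule.mem_span_singleton_self u)
      have h : HeckeRep.IsExtension (irrRep α) M (M.quotient _ inv) := by
        refine ⟨LinearMap.toSpanSingleton ℂ M.carrier u, Submodule.mkQ _, fun x v => ?_,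
          fun x v => rfl, ?_, Submodule.mkQ_surjective _, fun v => ?_⟩
        · have aux : ∀ v : ℂ, (heckeChar (compSetEquiv n α) x * v) • u = M.ρ x (v • u) := fun v => by
            rw [map_smul, hx, smul_smul, mul_comm]
          exact aux v
        · exact smul_left_injective ℂ hu
        · erw [Submodule.mkQ_apply, Submodule.Quotient.mk_eq_zero]
          rw [Submodule.mem_span_singleton]
          rfl
      rw [h.cls]
      refine add_mem (AddSubgroup.subset_closure ⟨α, rfl⟩) (ih _ ?_ _ rfl)
      have := Submodule.finrank_quotient_add_finrank (Submodule.span ℂ {u})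
      rw [finrank_span_singleton hu, hd] at this
      change Module.finrank ℂ (M.carrier ⧸ Submodule.span ℂ {u}) < d
      omega

theorem existsUnique_quasiChar : ∃! ch : HeckeG →+ QSym,
    ∀ (n : ℕ) (α : Composition n), ch (irrRep α).cls = fundamentalQSym α := by
  obtain ⟨ch, hch⟩ := exists_quasiChar
  refine ⟨ch, hch, fun ch' hch' => ?_⟩
  refine DirectSum.addHom_ext' fun n => ?_
  refine QuotientAddGroup.addMonoidHom_ext _ ?_
  refine FreeAbelianGroup.lift_ext _ _ fun M => ?_
  change ch' M.cls = ch M.cls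
  have h := M.cls_mem_closure
  generalize M.cls = y at h
  induction h using AddSubgroup.closure_induction with
  | mem x hx => obtain ⟨α, rfl⟩ := hx; rw [hch, hch']
  | zero => simp
  | add x y _ _ hx hy => rw [map_add, map_add, hx, hy]
  | neg x _ hx => rw [map_neg, map_neg, hx]

/-- The quasisymmetric characteristic map `ch : 𝒢 → QSym`: the unique (`ℤ`-)linear map with
`[𝐅_α] ↦ F_α` for all compositions `α`. -/
noncomputable def quasiChar : HeckeG →+ QSym := existsUnique_quasiChar.choose

theorem quasiChar_irrRep {n : ℕ} (α : Composition n) :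
    quasiChar (irrRep α).cls = fundamentalQSym α :=
  existsUnique_quasiChar.choose_spec.1 n α

end

/-! Existence: a chain of covers from the inner to the outer shape adds one cell at a time. Giving
each new cell the smallest entry and raising all the others by one keeps every tableau condition
(`HasTableau.of_chain`). When a part is enlarged, the triple rule survives because no earlier part
has the same size.

Action: whether a flip fixes, kills or interchanges depends only on the positions of the two
entries. The 0-Hecke relations therefore hold on the span of all fillings, by cases on the positions
of the entries involved (`skewFlip_idem`, `skewFlip_comm`, `skewFlip_braid`). A nonzero flip sends
tableaux to tableaux (`IsSRCT.swapEntries`), since consecutive values compare in the same way with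
every other value. A minimum of the total order lies below every tableau, so the module is the span
of all of them.

Order: an interchange moves the larger of two entries to the left, so the sum of entry times column
drops (`weight_swapEntries_lt`), which gives antisymmetry. For transitivity, concatenated words need
not be reduced. After deleting the letters that act trivially, each remaining letter creates a new
inversion, so the shortened word is reduced (`exists_reduced_of_flips`).

Characteristic: the multiplicity of each one-dimensional module is the trace of a product of factors
`T i` and `1 - T i` (`quasiChar_cls`). In the basis of tableaux the generators are triangular with
respect to the weight, with diagonal entry 0 at descents and 1 elsewhere. The trace thus counts the
tableaux with a given descent set (`quasiChar_of_triangular`). -/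

section

/-! ### Existence of tableaux -/

/-- The cells of the skew shape with row lengths `o` (outer) and `n` (inner). -/
def rowCells (o n : ℕ → ℕ) : Set (ℕ × ℕ) := {c | n c.1 ≤ c.2 ∧ c.2 < o c.1}

theorem mem_rowCells {o n : ℕ → ℕ} {i j : ℕ} : (i, j) ∈ rowCells o n ↔ n i ≤ j ∧ j < o i := Iff.rfl

/-- There is a skew tableau of size `m` for the row lengths `o` (outer) and `n` (inner). -/
def HasTableau (o n : ℕ → ℕ) (m : ℕ) : Prop :=
  ∃ f : ℕ × ℕ → ℕ, Set.BijOn f (rowCells o n) (Set.Iio m) ∧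
    (∀ i c d, (i, c) ∈ rowCells o n → (i, d) ∈ rowCells o n → c < d → f (i, d) < f (i, c)) ∧
    (∀ i j, (i, 0) ∈ rowCells o n → (j, 0) ∈ rowCells o n → i < j → f (i, 0) < f (j, 0)) ∧
    ∀ i j k, i < j → (j, k + 1) ∈ rowCells o n →
      (k < n i ∨ ((i, k) ∈ rowCells o n ∧ f (j, k + 1) < f (i, k))) →
      (k + 1 < n i ∨ ((i, k + 1) ∈ rowCells o n ∧ f (j, k + 1) < f (i, k + 1)))

theorem hasTableau_self (o : ℕ → ℕ) : HasTableau o o 0 := by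
  have h : rowCells o o = ∅ := by
    ext ⟨i, j⟩
    simp [rowCells]
  refine ⟨fun _ => 0, ?_, ?_, ?_, ?_⟩ <;> simp [h]

/-- The new cell is on top of the first column and gets the entry 0; old entries go up by one. The
triple rule is vacuous for the new row, because 0 exceeds no entry and the row has no inner cell. -/
theorem HasTableau.cons {o n o' n' : ℕ → ℕ} {m : ℕ} (h : HasTableau o n m)
    (ho0 : o' 0 = 1) (hn0 : n' 0 = 0) (ho : ∀ i, o' (i + 1) = o i) (hn : ∀ i, n' (i + 1) = n i) :
    HasTableau o' n' (m + 1) := by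
  obtain ⟨f, hf, hr, hc, ht⟩ := h
  have hmem : ∀ i j, (i + 1, j) ∈ rowCells o' n' ↔ (i, j) ∈ rowCells o n := by
    intro i j
    simp [mem_rowCells, ho, hn]
  have hmem0 : ∀ j, (0, j) ∈ rowCells o' n' ↔ j = 0 := by
    intro j
    simp [mem_rowCells, ho0, hn0]
  refine ⟨fun c => Nat.casesOn c.1 0 fun i => f (i, c.2) + 1, ⟨?_, ?_, ?_⟩, ?_, ?_, ?_⟩
  · rintro ⟨_ | i, j⟩ hij
    · simp
    · have := hf.mapsTo ((hmem _ _).1 hij)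
      simpa using this
  · rintro ⟨_ | i, j⟩ hij ⟨_ | i', j'⟩ hij' he
    · rw [(hmem0 _).1 hij, (hmem0 _).1 hij']
    · simp at he
    · simp at he
    · have := hf.injOn ((hmem _ _).1 hij) ((hmem _ _).1 hij') (by simpa using he)
      simpa using this
  · rintro (_ | x) hx
    · exact ⟨(0, 0), (hmem0 _).2 rfl, rfl⟩
    · obtain ⟨⟨i, j⟩, hij, he⟩ := hf.surjOn (show x ∈ Set.Iio m by simpa using hx)
      exact ⟨(i + 1, j), (hmem _ _).2 hij, by simp [he]⟩
  · rintro (_ | i) c d h1 h2 hcd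
    · rw [hmem0] at h1 h2
      omega
    · simpa using hr i c d ((hmem _ _).1 h1) ((hmem _ _).1 h2) hcd
  · rintro (_ | i) (_ | j) h1 h2 hij
    · omega
    · simp
    · omega
    · simpa using hc i j ((hmem _ _).1 h1) ((hmem _ _).1 h2) (by omega)
  · rintro (_ | i) (_ | j) k hij h1 h2
    · omega
    · simp [hn0] at h2
    · omega
    · simpa [hmem, hn] using ht i j k (by omega) ((hmem _ _).1 h1) (by simpa [hmem, hn] using h2)

/-- The new cell, last in row `p`, gets the entry 0 and old entries go up by one. By `hpos` it lies
outside the first column. Only the triples whose lower right cell is the new one need an argument,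
and there `hp` enters. -/
theorem HasTableau.add {o n o' : ℕ → ℕ} {m p : ℕ} (h : HasTableau o n m) (hno : ∀ i, n i ≤ o i)
    (hpos : 0 < o p) (hp : ∀ i < p, o i ≠ o p) (hop : o' p = o p + 1)
    (ho : ∀ i, i ≠ p → o' i = o i) : HasTableau o' n (m + 1) := by
  obtain ⟨f, hf, hr, hc, ht⟩ := h
  have hmem : ∀ i j, (i, j) ∈ rowCells o' n ↔ (i, j) ∈ rowCells o n ∨ (i, j) = (p, o p) := by
    intro i j
    rw [mem_rowCells, mem_rowCells, Prod.mk.injEq]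
    rcases eq_or_ne i p with rfl | hi
    · have := hno i
      rw [hop]
      omega
    · rw [ho i hi]
      simp [hi]
  have hnot : (p, o p) ∉ rowCells o n := by simp [mem_rowCells]
  have hne : ∀ {c}, c ∈ rowCells o n → c ≠ (p, o p) := by
    rintro c h rfl
    exact hnot h
  let g : ℕ × ℕ → ℕ := fun c => if c = (p, o p) then 0 else f c + 1
  have gnew : g (p, o p) = 0 := by simp [g]
  have gold : ∀ {c}, c ∈ rowCells o n → g c = f c + 1 := fun h => by simp [g, hne h]
  refine ⟨g, ⟨?_, ?_, ?_⟩, ?_, ?_, ?_⟩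
  · rintro ⟨i, j⟩ hij
    rcases (hmem _ _).1 hij with h | h
    · have := hf.mapsTo h
      rw [gold h]
      simpa using this
    · rw [h, gnew]
      simp
  · rintro ⟨i, j⟩ hij ⟨i', j'⟩ hij' he
    rcases (hmem _ _).1 hij with h | h <;> rcases (hmem _ _).1 hij' with h' | h'
    · rw [gold h, gold h'] at he
      exact hf.injOn h h' (by omega)
    · rw [h', gold h, gnew] at he
      omega
    · rw [h, gold h', gnew] at he
      omega
    · rw [h, h']
  · rintro (_ | x) hx
    · exact ⟨(p, o p), (hmem _ _).2 (Or.inr rfl), gnew⟩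
    · obtain ⟨⟨i, j⟩, hij, he⟩ := hf.surjOn (show x ∈ Set.Iio m by simpa using hx)
      exact ⟨(i, j), (hmem _ _).2 (Or.inl hij), by rw [gold hij, he]⟩
  · intro i c d h1 h2 hcd
    rcases (hmem _ _).1 h1 with h | h <;> rcases (hmem _ _).1 h2 with h' | h'
    · rw [gold h, gold h']
      have := hr i c d h h' hcd
      omega
    · rw [h', gold h, gnew]
      omega
    · rw [Prod.mk.injEq] at h
      obtain ⟨rfl, rfl⟩ := h
      have := h'.2
      simp only at this
      omega
    · rw [Prod.mk.injEq] at h h'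
      omega
  · intro i j h1 h2 hij
    rcases (hmem _ _).1 h1 with h | h <;> rcases (hmem _ _).1 h2 with h' | h'
    · rw [gold h, gold h']
      have := hc i j h h' hij
      omega
    all_goals
      rw [Prod.mk.injEq] at *
      omega
  · intro i j k hij h1 h2
    rcases (hmem _ _).1 h1 with h | h
    · rw [gold h] at h2 ⊢
      -- The new cell cannot be the upper left cell of the triple: its entry 0 exceeds nothing.
      have key : k < n i ∨ ((i, k) ∈ rowCells o n ∧ f (j, k + 1) < f (i, k)) := by
        refine h2.imp_right ?_
        rintro ⟨h3, h4⟩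
        rcases (hmem _ _).1 h3 with h5 | h5
        · rw [gold h5] at h4
          exact ⟨h5, by omega⟩
        · rw [h5, gnew] at h4
          omega
      refine (ht i j k hij h key).imp_right ?_
      rintro ⟨h3, h4⟩
      exact ⟨(hmem _ _).2 (Or.inl h3), by rw [gold h3]; omega⟩
    · rw [Prod.mk.injEq] at h
      obtain ⟨rfl, hk⟩ := h
      have hi := hno i
      have hpi := hp i hij
      -- Row `i` reaches column `k`, so `o i ≥ k + 1 = o p`. As these lengths differ, row `i` also
      -- reaches column `k + 1`, where it has an inner cell or an old, hence larger, entry.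
      have hik : k < o i := by
        rcases h2 with h3 | ⟨h3, -⟩
        · omega
        · have := h3.2
          rw [ho i hij.ne] at this
          exact this
      rw [or_iff_not_imp_left]
      intro h3
      have h5 : (i, k + 1) ∈ rowCells o n := by
        rw [mem_rowCells]
        omega
      refine ⟨(hmem _ _).2 (Or.inl h5), ?_⟩
      rw [gold h5, hk, gnew]
      omega

/-! ### Tableaux from chains in the reverse composition poset -/

/-- The row lengths of the inner shape `B` drawn in the bottom left corner of `L`. -/
def innerRow (L B : List ℕ) (i : ℕ) : ℕ :=
  if i + B.length < L.length then 0 else B.getD (i + B.length - L.length) 0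

theorem RCCovers.eq_or_exists {L M : List ℕ} (h : RCCovers L M) :
    M = 1 :: L ∨ ∃ l k r, k ∉ l ∧ L = l ++ k :: r ∧ M = l ++ (k + 1) :: r := by
  cases h with
  | add l k r h => exact Or.inr ⟨l, k, r, h, rfl, rfl⟩
  | _ => exact Or.inl rfl

/-- Induction on the chain, with one new cell per cover. The inner shape is anchored at the bottom,
so prefixing a part shifts its rows by one and enlarging a part leaves them alone. Positivity and
containment are carried along as hypotheses of `HasTableau.add`. -/
theorem HasTableau.of_chain {B L : List ℕ} (hB : ∀ x ∈ B, 0 < x)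
    (h : Relation.ReflTransGen RCCovers B L) :
    (∀ x ∈ L, 0 < x) ∧ B.length ≤ L.length ∧ (∀ i, innerRow L B i ≤ L.getD i 0) ∧
      ∃ m, B.sum + m = L.sum ∧ HasTableau (fun i => L.getD i 0) (innerRow L B) m := by
  induction h with
  | refl =>
    have h : innerRow B B = fun i => B.getD i 0 := by
      ext i
      simp [innerRow]
    refine ⟨hB, le_rfl, fun i => by rw [h], 0, by simp, ?_⟩
    rw [h]
    exact hasTableau_self _
  | @tail L _ _ hc ih =>
    obtain ⟨hL, hlen, hle, m, hm, ht⟩ := ih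
    rcases hc.eq_or_exists with rfl | ⟨l, k, r, hk, rfl, rfl⟩
    · have h0 : innerRow (1 :: L) B 0 = 0 := by
        simp only [innerRow, List.length_cons]
        rw [if_pos (by omega)]
      have hs : ∀ i, innerRow (1 :: L) B (i + 1) = innerRow L B i := by
        intro i
        simp only [innerRow, List.length_cons]
        rw [show i + 1 + B.length - (L.length + 1) = i + B.length - L.length by omega]
        exact if_congr (by omega) rfl rfl
      refine ⟨by simpa using hL, by simp; omega, ?_, m + 1, by simp; omega,
        ht.cons (by simp) h0 (by simp) hs⟩
      rintro (_ | i)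
      · simp [h0]
      · simpa [hs] using hle i
    · have hin : innerRow (l ++ (k + 1) :: r) B = innerRow (l ++ k :: r) B := by
        ext i
        simp [innerRow]
      have hp : (l ++ k :: r).getD l.length 0 = k := by simp
      have hp' : (l ++ (k + 1) :: r).getD l.length 0 = k + 1 := by simp
      have hne : ∀ i, i ≠ l.length →
          (l ++ (k + 1) :: r).getD i 0 = (l ++ k :: r).getD i 0 := by
        intro i hi
        rcases lt_or_gt_of_ne hi with h | h
        · rw [List.getD_append _ _ _ _ h, List.getD_append _ _ _ _ h]
        · rw [List.getD_append_right _ _ _ _ h.le, List.getD_append_right _ _ _ _ h.le]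
          obtain ⟨d, hd⟩ : ∃ d, i - l.length = d + 1 := ⟨i - l.length - 1, by omega⟩
          simp [hd]
      refine ⟨?_, by simpa using hlen, ?_, m + 1, by simp at hm ⊢; omega, ?_⟩
      · intro x hx
        have := hL x
        simp at hx this
        rcases hx with h | h | h
        · exact this (Or.inl h)
        · omega
        · exact this (Or.inr (Or.inr h))
      · intro i
        rw [hin]
        refine (hle i).trans ?_
        rcases eq_or_ne i l.length with rfl | hi
        · rw [hp, hp']
          omega
        · rw [hne i hi]
      · rw [hin]
        refine ht.add (p := l.length) hle ?_ ?_ ?_ hne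
        · rw [hp]
          exact hL k (by simp)
        · intro i hi
          rw [hp, List.getD_append _ _ _ _ hi, List.getD_eq_getElem _ _ hi]
          rintro rfl
          exact hk (List.getElem_mem hi)
        · rw [hp, hp']

/-! ### From row lengths to skew shapes of compositions -/

theorem mem_skewCells {a b : ℕ} {α : Composition a} {β : Composition b} {c : ℕ × ℕ} :
    c ∈ skewCells α β ↔ c ∈ rowCells (outerLen α) (innerLen α β) := by
  obtain ⟨i, j⟩ := c
  simp only [skewCells, Finset.mem_filter, Finset.mem_product, Finset.mem_range, mem_rowCells,
    and_iff_right_iff_imp]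
  rintro ⟨-, h⟩
  have hi : i < α.length := by
    by_contra hc
    rw [outerLen, List.getD_eq_default _ _ (by simpa using hc)] at h
    omega
  refine ⟨hi, h.trans_le ?_⟩
  rw [outerLen, List.getD_eq_getElem _ _ hi]
  exact (List.le_sum_of_mem (List.getElem_mem hi)).trans_eq α.blocks_sum

namespace SkewFilling

variable {a b m : ℕ} {α : Composition a} {β : Composition b}

theorem entry_of_mem (τ : SkewFilling α β m) {c : ℕ × ℕ} (h : c ∈ skewCells α β) :
    τ.entry c = ((τ ⟨c, h⟩ : ℕ) + 1 : ℕ) := by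
  rw [entry, dif_pos h]

theorem entry_of_lt (τ : SkewFilling α β m) {c : ℕ × ℕ} (h : c.2 < innerLen α β c.1) :
    τ.entry c = ⊤ := by
  have h' : c ∉ skewCells α β := fun hc => absurd (mem_skewCells.1 hc).1 (by omega)
  rw [entry, dif_neg h', if_pos h]

/-- Removes the conventions for `entry`: inner positions hold `⊤` and always exceed, positions
outside the diagram hold 0 and never do. The triple rule takes the form used in `HasTableau`. -/
theorem lt_entry_iff (τ : SkewFilling α β m) {c : ℕ × ℕ} (x : ℕ) :
    ((x + 1 : ℕ) : ℕ∞) < τ.entry c ↔ c.2 < innerLen α β c.1 ∨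
      ∃ h : c ∈ skewCells α β, x < τ ⟨c, h⟩ := by
  by_cases h : c ∈ skewCells α β
  · have h' : ¬ c.2 < innerLen α β c.1 := by
      have := (mem_skewCells.1 h).1
      omega
    rw [entry_of_mem τ h, Nat.cast_lt]
    simp [h, h']
  · by_cases h' : c.2 < innerLen α β c.1
    · rw [entry_of_lt τ h']
      simp [h', -Nat.cast_add]
    · rw [entry, dif_neg h, if_neg h']
      simp [h, h']

end SkewFilling

theorem SkewSRCT.nonempty {a b m : ℕ} {α : Composition a} {β : Composition b}
    (hlt : RCLT β α) (hm : b + m = a) : Nonempty (SkewSRCT α β m) := by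
  obtain ⟨-, -, -, m', hm', f, hf, hr, hc, ht⟩ :=
    HasTableau.of_chain (fun x hx => β.blocks_pos hx) hlt.to_reflTransGen
  obtain rfl : m' = m := by
    rw [α.blocks_sum, β.blocks_sum] at hm'
    omega
  have hcells : ∀ {c}, c ∈ skewCells α β ↔
      c ∈ rowCells (fun i => α.blocks.getD i 0) (innerRow α.blocks β.blocks) := mem_skewCells
  let τ : SkewFilling α β m' := Equiv.ofBijective
    (fun c => ⟨f c, hf.mapsTo (hcells.1 c.2)⟩) (by
      constructor
      · intro c d h
        exact Subtype.ext (hf.injOn (hcells.1 c.2) (hcells.1 d.2) (congrArg Fin.val h))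
      · rintro ⟨x, hx⟩
        obtain ⟨c, hc, he⟩ := hf.surjOn (show x ∈ Set.Iio m' from hx)
        exact ⟨⟨c, hcells.2 hc⟩, Fin.ext he⟩)
  have hτ : ∀ c : skewCells α β, (τ c : ℕ) = f c := fun c => rfl
  refine ⟨τ, ⟨?_, ?_, ?_⟩⟩
  · rintro ⟨⟨i, c⟩, h1⟩ ⟨⟨i', d⟩, h2⟩ (rfl : i = i') hcd
    exact hr i c d (hcells.1 h1) (hcells.1 h2) hcd
  · rintro ⟨⟨i, c⟩, h1⟩ ⟨⟨j, d⟩, h2⟩ (rfl : c = 0) (rfl : d = 0) hij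
    exact hc i j (hcells.1 h1) (hcells.1 h2) hij
  · intro i j k hij hjk
    rw [SkewFilling.entry_of_mem τ hjk, SkewFilling.lt_entry_iff, SkewFilling.lt_entry_iff]
    intro h
    refine (ht i j k hij (hcells.1 hjk) (h.imp_right ?_)).imp_right ?_
    · rintro ⟨h1, h2⟩
      exact ⟨hcells.1 h1, h2⟩
    · rintro ⟨h1, h2⟩
      exact ⟨hcells.2 h1, h2⟩

end

/-! ### Flips preserve tableaux -/

section

namespace SkewFilling

variable {a b m : ℕ} {α : Composition a} {β : Composition b}

theorem lo_ne_hi (i : Fin (m - 1)) : (lo i : Fin m) ≠ hi i := by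
  simp [lo, hi, Fin.ext_iff]

theorem pos_apply (τ : SkewFilling α β m) (c : skewCells α β) : τ.pos (τ c) = c.1 := by
  simp [pos]

theorem pos_trans (τ : SkewFilling α β m) (σ : Equiv.Perm (Fin m)) (x : Fin m) :
    pos (τ.trans σ : SkewFilling α β m) x = τ.pos (σ.symm x) := rfl

theorem pos_swapEntries (τ : SkewFilling α β m) (i : Fin (m - 1)) (x : Fin m) :
    (τ.swapEntries i).pos x = τ.pos (Equiv.swap (lo i) (hi i) x) := rfl

theorem pos_swapEntries_lo (τ : SkewFilling α β m) (i : Fin (m - 1)) :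
    (τ.swapEntries i).pos (lo i) = τ.pos (hi i) := by
  rw [pos_swapEntries, Equiv.swap_apply_left]

theorem pos_swapEntries_hi (τ : SkewFilling α β m) (i : Fin (m - 1)) :
    (τ.swapEntries i).pos (hi i) = τ.pos (lo i) := by
  rw [pos_swapEntries, Equiv.swap_apply_right]

theorem pos_swapEntries_of_ne (τ : SkewFilling α β m) (i : Fin (m - 1)) {x : Fin m}
    (h1 : x ≠ lo i) (h2 : x ≠ hi i) : (τ.swapEntries i).pos x = τ.pos x := by
  rw [pos_swapEntries, Equiv.swap_apply_of_ne_of_ne h1 h2]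

theorem mem_descents {τ : SkewFilling α β m} {i : Fin (m - 1)} :
    i ∈ τ.descents ↔ (τ.pos (lo i)).2 ≤ (τ.pos (hi i)).2 := by
  simp [descents]

/-- `i` is a descent, and `i` and `i + 1` are not attacking. -/
def Flippable (τ : SkewFilling α β m) (i : Fin (m - 1)) : Prop :=
  i ∈ τ.descents ∧ ¬ τ.Attacking i

theorem Flippable.col_lt {τ : SkewFilling α β m} {i : Fin (m - 1)} (h : τ.Flippable i) :
    (τ.pos (lo i)).2 < (τ.pos (hi i)).2 :=
  lt_of_le_of_ne (mem_descents.1 h.1) fun h' => h.2 (Or.inl h')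

/-- No value lies strictly between two consecutive ones, so exchanging them reverses only their own
comparison. -/
theorem swap_lt_swap {i : Fin (m - 1)} {x y : Fin m} (h : x < y)
    (hxy : ¬ (x = lo i ∧ y = hi i)) :
    Equiv.swap (lo i) (hi i) x < Equiv.swap (lo i) (hi i) y := by
  simp only [Equiv.swap_apply_def, Fin.lt_def, Fin.ext_iff, lo, hi] at *
  split_ifs <;> (try dsimp only) <;> omega

theorem swapEntries_lt {τ : SkewFilling α β m} {i : Fin (m - 1)} {c d : skewCells α β}
    (h : τ c < τ d) (hcd : ¬ (τ.pos (lo i) = c ∧ τ.pos (hi i) = d)) :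
    τ.swapEntries i c < τ.swapEntries i d := by
  refine swap_lt_swap h fun h' => hcd ?_
  rw [← h'.1, ← h'.2, pos_apply, pos_apply]
  exact ⟨rfl, rfl⟩

theorem lt_of_swapEntries_lt {τ : SkewFilling α β m} {i : Fin (m - 1)} {c d : skewCells α β}
    (h : τ.swapEntries i c < τ.swapEntries i d)
    (hcd : ¬ (τ.pos (hi i) = c ∧ τ.pos (lo i) = d)) : τ c < τ d := by
  by_contra hlt
  have hne : c ≠ d := by
    rintro rfl
    exact lt_irrefl _ h
  have hdc : τ d < τ c := lt_of_le_of_ne (not_lt.1 hlt) fun h' => hne (τ.injective h').symm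
  exact lt_asymm h (swapEntries_lt hdc fun h' => hcd h'.symm)

theorem entry_lt_entry_iff (τ : SkewFilling α β m) (c : skewCells α β) {d : ℕ × ℕ} :
    τ.entry c < τ.entry d ↔ d.2 < innerLen α β d.1 ∨
      ∃ h : d ∈ skewCells α β, τ c < τ ⟨d, h⟩ := by
  rw [entry_of_mem τ c.2, lt_entry_iff]
  rfl

/-- Flips that are not zero produce tableaux. -/
theorem IsSRCT.swapEntries {τ : SkewFilling α β m} (hτ : τ.IsSRCT) {i : Fin (m - 1)}
    (h : τ.Flippable i) : (τ.swapEntries i).IsSRCT := by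
  have hcol := h.col_lt
  refine ⟨fun c d hr hc => ?_, fun c d hc hd hr => ?_, fun p q k hpq hq hlt => ?_⟩
  · refine swapEntries_lt (hτ.row c d hr hc) ?_
    rintro ⟨h1, h2⟩
    rw [h1, h2] at hcol
    omega
  · refine swapEntries_lt (hτ.col c d hc hd hr) ?_
    rintro ⟨h1, h2⟩
    rw [h1, h2] at hcol
    omega
  · have e1 := fun (τ : SkewFilling α β m) (d : ℕ × ℕ) =>
      τ.entry_lt_entry_iff ⟨(q, k + 1), hq⟩ (d := d)
    simp only at e1
    rw [e1] at hlt ⊢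
    -- The interchange could create this inequality only with `lo i` at `(p, k)` and `hi i` at `(q,
    -- k + 1)`, which is an attacking pair.
    have key : τ.entry (q, k + 1) < τ.entry (p, k) := by
      rw [e1]
      refine hlt.imp_right ?_
      rintro ⟨h1, h2⟩
      refine ⟨h1, lt_of_swapEntries_lt h2 ?_⟩
      rintro ⟨h3, h4⟩
      refine h.2 (Or.inr ?_)
      rw [h3, h4]
      exact ⟨rfl, hpq⟩
    refine ((e1 τ _).1 (hτ.triple p q k hpq hq key)).imp_right ?_
    rintro ⟨h1, h2⟩
    refine ⟨h1, swapEntries_lt h2 ?_⟩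
    -- It could destroy the conclusion only if both entries were in column `k + 1`, against `hcol`.
    rintro ⟨h3, h4⟩
    rw [h3, h4] at hcol
    exact lt_irrefl _ hcol

end SkewFilling

open SkewFilling

/-! ### The flips satisfy the relations of the `0`-Hecke algebra -/

section Flip

variable {a b m : ℕ} {α : Composition a} {β : Composition b}

theorem skewFlip_of_notMem {τ : SkewFilling α β m} {i : Fin (m - 1)} (h : i ∉ τ.descents) :
    skewFlip α β i (Finsupp.single τ 1) = Finsupp.single τ 1 := by
  simp [skewFlip, h]

theorem skewFlip_of_attacking {τ : SkewFilling α β m} {i : Fin (m - 1)} (h : i ∈ τ.descents)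
    (h' : τ.Attacking i) : skewFlip α β i (Finsupp.single τ 1) = 0 := by
  simp [skewFlip, h, h']

theorem skewFlip_of_flippable {τ : SkewFilling α β m} {i : Fin (m - 1)} (h : τ.Flippable i) :
    skewFlip α β i (Finsupp.single τ 1) = Finsupp.single (τ.swapEntries i) 1 := by
  simp [skewFlip, h.1, h.2]

theorem flip_cases (τ : SkewFilling α β m) (i : Fin (m - 1)) :
    i ∉ τ.descents ∨ (i ∈ τ.descents ∧ τ.Attacking i) ∨ τ.Flippable i := by
  unfold Flippable
  tauto

theorem Flippable.notMem_swapEntries {τ : SkewFilling α β m} {i : Fin (m - 1)}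
    (h : τ.Flippable i) : i ∉ (τ.swapEntries i).descents := by
  rw [mem_descents, pos_swapEntries_lo, pos_swapEntries_hi, not_le]
  exact h.col_lt

theorem skewFlip_hom_ext {f g : Module.End ℂ (SkewFilling α β m →₀ ℂ)}
    (h : ∀ τ, f (Finsupp.single τ 1) = g (Finsupp.single τ 1)) : f = g :=
  Finsupp.lhom_ext' fun τ => LinearMap.ext_ring (h τ)

theorem skewFlip_idem (i : Fin (m - 1)) :
    skewFlip α β i * skewFlip α β i = skewFlip α β i := by
  refine skewFlip_hom_ext fun τ => ?_
  rw [Module.End.mul_apply]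
  rcases flip_cases τ i with h | h | h
  · rw [skewFlip_of_notMem h, skewFlip_of_notMem h]
  · rw [skewFlip_of_attacking h.1 h.2, map_zero]
  · rw [skewFlip_of_flippable h, skewFlip_of_notMem (Flippable.notMem_swapEntries h)]

theorem mem_descents_congr {τ τ' : SkewFilling α β m} {i j : Fin (m - 1)}
    (h1 : τ.pos (lo i) = τ'.pos (lo j)) (h2 : τ.pos (hi i) = τ'.pos (hi j)) :
    (i ∈ τ.descents ↔ j ∈ τ'.descents) := by
  rw [mem_descents, mem_descents, h1, h2]

theorem attacking_congr {τ τ' : SkewFilling α β m} {i j : Fin (m - 1)}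
    (h1 : τ.pos (lo i) = τ'.pos (lo j)) (h2 : τ.pos (hi i) = τ'.pos (hi j)) :
    (τ.Attacking i ↔ τ'.Attacking j) := by
  rw [Attacking, Attacking, h1, h2]

theorem flippable_congr {τ τ' : SkewFilling α β m} {i j : Fin (m - 1)}
    (h1 : τ.pos (lo i) = τ'.pos (lo j)) (h2 : τ.pos (hi i) = τ'.pos (hi j)) :
    (τ.Flippable i ↔ τ'.Flippable j) := by
  rw [Flippable, Flippable, mem_descents_congr h1 h2, attacking_congr h1 h2]

/-- The four entries involved are distinct, so neither flip changes the positions that decide the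
other, and disjoint transpositions commute. -/
theorem skewFlip_comm (i j : Fin (m - 1)) (hij : (i : ℕ) + 2 ≤ j) :
    skewFlip α β i * skewFlip α β j = skewFlip α β j * skewFlip α β i := by
  refine skewFlip_hom_ext fun τ => ?_
  rw [Module.End.mul_apply, Module.End.mul_apply]
  have n1 : (lo i : Fin m) ≠ lo j := by simp [lo, Fin.ext_iff]; omega
  have n2 : (lo i : Fin m) ≠ hi j := by simp [lo, hi, Fin.ext_iff]; omega
  have n3 : (hi i : Fin m) ≠ lo j := by simp [lo, hi, Fin.ext_iff]; omega
  have n4 : (hi i : Fin m) ≠ hi j := by simp [hi, Fin.ext_iff]; omega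
  have i1 := τ.pos_swapEntries_of_ne j n1 n2
  have i2 := τ.pos_swapEntries_of_ne j n3 n4
  have j1 := τ.pos_swapEntries_of_ne i n1.symm n3.symm
  have j2 := τ.pos_swapEntries_of_ne i n2.symm n4.symm
  rcases flip_cases τ i with h | ⟨h, h'⟩ | h <;> rcases flip_cases τ j with g | ⟨g, g'⟩ | g
  · simp only [skewFlip_of_notMem h, skewFlip_of_notMem g]
  · rw [skewFlip_of_notMem h, skewFlip_of_attacking g g', map_zero]
  · rw [skewFlip_of_notMem h, skewFlip_of_flippable g,
      skewFlip_of_notMem (mt (mem_descents_congr i1 i2).1 h)]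
  · rw [skewFlip_of_attacking h h', skewFlip_of_notMem g, skewFlip_of_attacking h h', map_zero]
  · rw [skewFlip_of_attacking h h', skewFlip_of_attacking g g', map_zero, map_zero]
  · rw [skewFlip_of_attacking h h', skewFlip_of_flippable g, map_zero,
      skewFlip_of_attacking ((mem_descents_congr i1 i2).2 h) ((attacking_congr i1 i2).2 h')]
  · rw [skewFlip_of_flippable h, skewFlip_of_notMem g, skewFlip_of_flippable h,
      skewFlip_of_notMem (mt (mem_descents_congr j1 j2).1 g)]
  · rw [skewFlip_of_flippable h, skewFlip_of_attacking g g', map_zero,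
      skewFlip_of_attacking ((mem_descents_congr j1 j2).2 g) ((attacking_congr j1 j2).2 g')]
  · rw [skewFlip_of_flippable h, skewFlip_of_flippable g,
      skewFlip_of_flippable ((flippable_congr i1 i2).2 h),
      skewFlip_of_flippable ((flippable_congr j1 j2).2 g)]
    congr 1
    ext c
    simp only [swapEntries, Equiv.trans_apply]
    rw [← Equiv.Perm.mul_apply, ← Equiv.Perm.mul_apply,
      (Equiv.Perm.disjoint_swap_swap (by
        simp [n1, n2, n3, n4, lo_ne_hi])).commute.eq]

/-- Attacking positions. -/
def AttackingPos (p q : ℕ × ℕ) : Prop := p.2 = q.2 ∨ (q.2 = p.2 + 1 ∧ p.1 < q.1)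

theorem skewFlip_eq_self {τ : SkewFilling α β m} {i : Fin (m - 1)} {p q : ℕ × ℕ}
    (hp : τ.pos (lo i) = p) (hq : τ.pos (hi i) = q) (h : q.2 < p.2) :
    skewFlip α β i (Finsupp.single τ 1) = Finsupp.single τ 1 :=
  skewFlip_of_notMem (by rw [mem_descents, hp, hq]; omega)

theorem skewFlip_eq_zero {τ : SkewFilling α β m} {i : Fin (m - 1)} {p q : ℕ × ℕ}
    (hp : τ.pos (lo i) = p) (hq : τ.pos (hi i) = q) (h : AttackingPos p q) :
    skewFlip α β i (Finsupp.single τ 1) = 0 :=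
  skewFlip_of_attacking (by rw [mem_descents, hp, hq]; rcases h with h | h <;> omega)
    (by rw [Attacking, hp, hq]; exact h)

theorem skewFlip_eq_swap {τ : SkewFilling α β m} {i : Fin (m - 1)} {p q : ℕ × ℕ}
    (hp : τ.pos (lo i) = p) (hq : τ.pos (hi i) = q) (h : p.2 < q.2) (h' : ¬ AttackingPos p q) :
    skewFlip α β i (Finsupp.single τ 1) = Finsupp.single (τ.swapEntries i) 1 :=
  skewFlip_of_flippable ⟨by rw [mem_descents, hp, hq]; omega, by rw [Attacking, hp, hq]; exact h'⟩

/-- The positions of the entries exchanged by the two consecutive transpositions `i` and `j`. -/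
def TriplePos (τ : SkewFilling α β m) (i j : Fin (m - 1)) (x y z : ℕ × ℕ) : Prop :=
  τ.pos (lo i) = x ∧ τ.pos (hi i) = y ∧ τ.pos (lo j) = y ∧ τ.pos (hi j) = z

theorem TriplePos.swap_left {τ : SkewFilling α β m} {i j : Fin (m - 1)} {x y z : ℕ × ℕ}
    (hij : (i : ℕ) + 1 = j) (h : TriplePos τ i j x y z) :
    TriplePos (τ.swapEntries i) i j y x z := by
  have e : (lo j : Fin m) = hi i := by simp [lo, hi, hij]
  obtain ⟨h1, h2, -, h4⟩ := h
  refine ⟨?_, ?_, ?_, ?_⟩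
  · rw [pos_swapEntries_lo, h2]
  · rw [pos_swapEntries_hi, h1]
  · rw [e, pos_swapEntries_hi, h1]
  · rw [pos_swapEntries_of_ne, h4] <;> simp [lo, hi, Fin.ext_iff] <;> omega

theorem TriplePos.swap_right {τ : SkewFilling α β m} {i j : Fin (m - 1)} {x y z : ℕ × ℕ}
    (hij : (i : ℕ) + 1 = j) (h : TriplePos τ i j x y z) :
    TriplePos (τ.swapEntries j) i j x z y := by
  have e : (hi i : Fin m) = lo j := by simp [lo, hi, hij]
  obtain ⟨h1, -, h3, h4⟩ := h
  refine ⟨?_, ?_, ?_, ?_⟩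
  · rw [pos_swapEntries_of_ne, h1] <;> simp [lo, hi, Fin.ext_iff] <;> omega
  · rw [e, pos_swapEntries_lo, h4]
  · rw [pos_swapEntries_lo, h4]
  · rw [pos_swapEntries_hi, h3]

theorem pos_cases (p q : ℕ × ℕ) :
    q.2 < p.2 ∨ AttackingPos p q ∨ (p.2 < q.2 ∧ ¬ AttackingPos p q) := by
  unfold AttackingPos
  omega

/-- Both products of transpositions equal the transposition of the outer entries `lo i` and `hi j`.
-/
theorem swapEntries_braid (τ : SkewFilling α β m) {i j : Fin (m - 1)} (hij : (i : ℕ) + 1 = j) :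
    ((τ.swapEntries i).swapEntries j).swapEntries i =
      ((τ.swapEntries j).swapEntries i).swapEntries j := by
  have e : (lo j : Fin m) = hi i := by simp [lo, hi, hij]
  have n1 : (lo i : Fin m) ≠ hi i := lo_ne_hi i
  have n2 : (hi j : Fin m) ≠ hi i := by rw [← e]; exact (lo_ne_hi j).symm
  have n3 : (lo i : Fin m) ≠ hi j := by simp [lo, hi, Fin.ext_iff]; omega
  have h1 := Equiv.swap_mul_swap_mul_swap n2 n3.symm
  have h2 := Equiv.swap_mul_swap_mul_swap n1 n3
  rw [Equiv.swap_comm (hi i) (lo i), Equiv.swap_comm (hi j) (hi i)] at h1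
  refine Equiv.ext fun c => ?_
  simp only [swapEntries, Equiv.trans_apply, e, ← Equiv.Perm.mul_apply]
  rw [← mul_assoc, ← mul_assoc, h1, h2, Equiv.swap_comm]

/-- Everything is determined by the positions `x`, `y`, `z` of three consecutive entries: the types
of `(x, y)` and `(y, z)` give nine cases, with the type of `(x, z)` consulted when needed. A pair
already interchanged has decreasing columns and is fixed afterwards. -/
theorem skewFlip_braid (i j : Fin (m - 1)) (hij : (i : ℕ) + 1 = j) :
    skewFlip α β i * skewFlip α β j * skewFlip α β i =
      skewFlip α β j * skewFlip α β i * skewFlip α β j := by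
  refine skewFlip_hom_ext fun τ => ?_
  simp only [Module.End.mul_apply]
  obtain ⟨x, y, z, h⟩ : ∃ x y z, TriplePos τ i j x y z :=
    ⟨_, _, _, rfl, rfl, by rw [show (lo j : Fin m) = hi i by simp [lo, hi, hij]], rfl⟩
  have selfL {τ : SkewFilling α β m} {x y z} (h : TriplePos τ i j x y z) :=
    skewFlip_eq_self h.1 h.2.1
  have selfR {τ : SkewFilling α β m} {x y z} (h : TriplePos τ i j x y z) :=
    skewFlip_eq_self h.2.2.1 h.2.2.2
  have zeroL {τ : SkewFilling α β m} {x y z} (h : TriplePos τ i j x y z) :=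
    skewFlip_eq_zero h.1 h.2.1
  have zeroR {τ : SkewFilling α β m} {x y z} (h : TriplePos τ i j x y z) :=
    skewFlip_eq_zero h.2.2.1 h.2.2.2
  have swapL {τ : SkewFilling α β m} {x y z} (h : TriplePos τ i j x y z) :=
    skewFlip_eq_swap h.1 h.2.1
  have swapR {τ : SkewFilling α β m} {x y z} (h : TriplePos τ i j x y z) :=
    skewFlip_eq_swap h.2.2.1 h.2.2.2
  have hl := h.swap_left hij
  have hr := h.swap_right hij
  have hlr := hl.swap_right hij
  have hrl := hr.swap_left hij
  rcases pos_cases x y with a | a | ⟨a, a'⟩ <;> rcases pos_cases y z with b | b | ⟨b, b'⟩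
  · rw [selfL h a, selfR h b, selfL h a, selfR h b]
  · rw [selfL h a, zeroR h b, map_zero, map_zero]
  · rw [selfL h a, swapR h b b']
    rcases pos_cases x z with c | c | ⟨c, c'⟩
    · rw [selfL hr c, selfR hr b]
    · rw [zeroL hr c, map_zero]
    · rw [swapL hr c c', selfR hrl a]
  · rw [zeroL h a, selfR h b, zeroL h a, map_zero, map_zero]
  · rw [zeroL h a, zeroR h b, map_zero, map_zero, map_zero]
  · rw [zeroL h a, swapR h b b', map_zero, map_zero]
    rcases pos_cases x z with c | c | ⟨c, c'⟩
    -- Impossible: columns weakly increase from `x` to `y` and strictly from `y` to `z`.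
    · rcases a with a | a <;> omega
    · rw [zeroL hr c, map_zero]
    · rw [swapL hr c c', zeroR hrl a]
  · rw [selfR h b, swapL h a a']
    rcases pos_cases x z with c | c | ⟨c, c'⟩
    · rw [selfR hl c, selfL hl a]
    · rw [zeroR hl c, map_zero]
    · rw [swapR hl c c', selfL hlr b]
  · rw [swapL h a a', zeroR h b, map_zero, map_zero]
    rcases pos_cases x z with c | c | ⟨c, c'⟩
    · rcases b with b | b <;> omega
    · rw [zeroR hl c, map_zero]
    · rw [swapR hl c c', zeroL hlr b]
  · have c : x.2 < z.2 := by omega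
    -- Two strict column increases put `z` at least two columns right of `x`.
    have c' : ¬ AttackingPos x z := by
      unfold AttackingPos
      omega
    rw [swapL h a a', swapR h b b', swapR hl c c', swapL hr c c', swapL hlr b b', swapR hrl a a',
      swapEntries_braid τ hij]

end Flip

end

section

open SkewFilling

/-! ### Inversions and reduced words -/

/-- The inversions of a permutation. -/
def permInv {m : ℕ} (σ : Equiv.Perm (Fin m)) : Finset (Fin m × Fin m) :=
  Finset.univ.filter fun p => p.1 < p.2 ∧ σ p.2 < σ p.1

theorem mem_permInv {m : ℕ} {σ : Equiv.Perm (Fin m)} {x y : Fin m} :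
    (x, y) ∈ permInv σ ↔ x < y ∧ σ y < σ x := by
  simp [permInv]

theorem mem_permInv_swap_mul {m : ℕ} (σ : Equiv.Perm (Fin m)) (i : Fin (m - 1)) {x y : Fin m}
    (h : (x, y) ≠ (σ.symm (lo i), σ.symm (hi i))) (h' : (x, y) ≠ (σ.symm (hi i), σ.symm (lo i))) :
    (x, y) ∈ permInv (Equiv.swap (lo i) (hi i) * σ) ↔ (x, y) ∈ permInv σ := by
  rw [mem_permInv, mem_permInv, Equiv.Perm.mul_apply, Equiv.Perm.mul_apply]
  simp only [ne_eq, Prod.mk.injEq, Equiv.eq_symm_apply] at h h'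
  refine and_congr_right fun _ => ⟨fun hs => ?_, fun hs => swap_lt_swap hs fun hh => h' hh.symm⟩
  by_contra hlt
  have hne : σ x ≠ σ y := by
    intro he
    rw [he] at hs
    exact lt_irrefl _ hs
  exact lt_asymm hs (swap_lt_swap (lt_of_le_of_ne (not_lt.1 hlt) hne) h)

/-- Only the pair of arguments with values `lo i` and `hi i` changes its relative order. -/
theorem permInv_swap_mul {m : ℕ} (σ : Equiv.Perm (Fin m)) (i : Fin (m - 1))
    (h : σ.symm (lo i) < σ.symm (hi i)) :
    permInv (Equiv.swap (lo i) (hi i) * σ) = insert (σ.symm (lo i), σ.symm (hi i)) (permInv σ) := by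
  ext ⟨x, y⟩
  have hl : (lo i : Fin m) < hi i := by simp [lo, hi, Fin.lt_def]
  by_cases h1 : (x, y) = (σ.symm (lo i), σ.symm (hi i))
  · rw [h1]
    simp [mem_permInv, h, hl]
  by_cases h2 : (x, y) = (σ.symm (hi i), σ.symm (lo i))
  · rw [h2]
    simp [mem_permInv, h.ne, h.ne', h.not_gt]
  · rw [mem_permInv_swap_mul σ i h1 h2, Finset.mem_insert, or_iff_right h1]

theorem card_permInv_swap_mul {m : ℕ} (σ : Equiv.Perm (Fin m)) (i : Fin (m - 1))
    (h : σ.symm (lo i) < σ.symm (hi i)) :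
    (permInv (Equiv.swap (lo i) (hi i) * σ)).card = (permInv σ).card + 1 := by
  rw [permInv_swap_mul σ i h, Finset.card_insert_of_notMem]
  have hl : (lo i : Fin m) < hi i := by simp [lo, hi, Fin.lt_def]
  simp [mem_permInv, hl.le]

theorem card_permInv_swap_mul_le {m : ℕ} (σ : Equiv.Perm (Fin m)) (i : Fin (m - 1)) :
    (permInv (Equiv.swap (lo i) (hi i) * σ)).card ≤ (permInv σ).card + 1 := by
  rcases lt_or_gt_of_ne (σ.symm.injective.ne (lo_ne_hi i)) with h | h
  · exact (card_permInv_swap_mul σ i h).le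
  -- In the opposite order the product has one inversion fewer: multiplying it by the transposition
  -- again restores `σ`.
  · have := card_permInv_swap_mul (Equiv.swap (lo i) (hi i) * σ) i (by
      simpa [← Equiv.Perm.inv_def] using h)
    rw [← mul_assoc, Equiv.swap_mul_self, one_mul] at this
    omega

theorem wordPerm_cons {m : ℕ} (i : Fin (m - 1)) (w : List (Fin (m - 1))) :
    wordPerm (i :: w) = Equiv.swap (lo i) (hi i) * wordPerm w := by
  simp [wordPerm]

theorem card_permInv_wordPerm_le {m : ℕ} (w : List (Fin (m - 1))) :
    (permInv (wordPerm w)).card ≤ w.length := by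
  induction w with
  | nil =>
    rw [List.length_nil, Nat.le_zero, Finset.card_eq_zero, Finset.eq_empty_iff_forall_notMem]
    rintro ⟨x, y⟩ h
    rw [mem_permInv] at h
    exact lt_asymm h.1 h.2
  | cons i w ih =>
    rw [wordPerm_cons, List.length_cons]
    exact (card_permInv_swap_mul_le _ i).trans (by omega)

/-- The number of inversions bounds the length of every word for the permutation from below, so a
word attaining it is shortest. -/
theorem isReducedWord_of_length {m : ℕ} {w : List (Fin (m - 1))}
    (h : w.length = (permInv (wordPerm w)).card) : IsReducedWord w (wordPerm w) := by
  refine ⟨rfl, fun w' hw' => ?_⟩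
  rw [h, ← hw']
  exact card_permInv_wordPerm_le w'

/-! ### The partial order -/

variable {a b m : ℕ} {α : Composition a} {β : Composition b}

theorem single_one_injective {X : Type*} {x y : X}
    (h : (Finsupp.single x 1 : X →₀ ℂ) = Finsupp.single y 1) : x = y :=
  Finsupp.single_left_injective one_ne_zero h

theorem flips_eq_zero_or_single (τ : SkewFilling α β m) (w : List (Fin (m - 1))) :
    (w.map (skewFlip α β)).prod (Finsupp.single τ 1) = 0 ∨
      ∃ τ₀ : SkewFilling α β m,
        (w.map (skewFlip α β)).prod (Finsupp.single τ 1) = Finsupp.single τ₀ 1 := by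
  induction w with
  | nil => exact Or.inr ⟨τ, rfl⟩
  | cons i w ih =>
    rw [List.map_cons, List.prod_cons, Module.End.mul_apply]
    rcases ih with h | ⟨τ₀, h⟩
    · exact Or.inl (by rw [h, map_zero])
    · rw [h]
      rcases flip_cases τ₀ i with g | g | g
      · exact Or.inr ⟨_, skewFlip_of_notMem g⟩
      · exact Or.inl (skewFlip_of_attacking g.1 g.2)
      · exact Or.inr ⟨_, skewFlip_of_flippable g⟩

theorem exists_of_flips_cons {τ τ' : SkewFilling α β m} {i : Fin (m - 1)}
    {w : List (Fin (m - 1))}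
    (h : ((i :: w).map (skewFlip α β)).prod (Finsupp.single τ 1) = Finsupp.single τ' 1) :
    ∃ τ₀ : SkewFilling α β m,
      (w.map (skewFlip α β)).prod (Finsupp.single τ 1) = Finsupp.single τ₀ 1 ∧
      (τ' = τ₀ ∨ τ₀.Flippable i ∧ τ' = τ₀.swapEntries i) := by
  rw [List.map_cons, List.prod_cons, Module.End.mul_apply] at h
  rcases flips_eq_zero_or_single τ w with h₀ | ⟨τ₀, h₀⟩
  · rw [h₀, map_zero] at h
    exact absurd h.symm (Finsupp.single_ne_zero.2 one_ne_zero)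
  · rw [h₀] at h
    refine ⟨τ₀, h₀, ?_⟩
    rcases flip_cases τ₀ i with g | g | g
    · rw [skewFlip_of_notMem g] at h
      exact Or.inl (single_one_injective h).symm
    · rw [skewFlip_of_attacking g.1 g.2] at h
      exact absurd h.symm (Finsupp.single_ne_zero.2 one_ne_zero)
    · rw [skewFlip_of_flippable g] at h
      exact Or.inr ⟨g, (single_one_injective h).symm⟩

/-- Each tableau reached by flips is reached by a word all of whose flips interchange two entries,
and such a word is reduced. -/
theorem exists_reduced_of_flips (τ τ' : SkewFilling α β m) (w : List (Fin (m - 1)))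
    (h : (w.map (skewFlip α β)).prod (Finsupp.single τ 1) = Finsupp.single τ' 1) :
    ∃ w' : List (Fin (m - 1)), τ' = τ.trans (wordPerm w') ∧
      w'.length = (permInv (wordPerm w')).card ∧
      (w'.map (skewFlip α β)).prod (Finsupp.single τ 1) = Finsupp.single τ' 1 ∧
      ∀ p ∈ permInv (wordPerm w'), (τ.pos p.1).2 < (τ.pos p.2).2 := by
  induction w generalizing τ' with
  | nil =>
    have e : (wordPerm [] : Equiv.Perm (Fin m)) = 1 := rfl
    have e' : permInv (1 : Equiv.Perm (Fin m)) = ∅ := by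
      rw [Finset.eq_empty_iff_forall_notMem]
      rintro ⟨x, y⟩ h
      rw [mem_permInv] at h
      exact lt_asymm h.1 h.2
    obtain rfl := single_one_injective h
    exact ⟨[], rfl, by simp [e, e'], h, by simp [e, e']⟩
  | cons i w ih =>
    obtain ⟨τ₀, h₀, rfl | ⟨g, rfl⟩⟩ := exists_of_flips_cons h
    · exact ih _ h₀
    · obtain ⟨w', h1, h2, h3, h4⟩ := ih τ₀ h₀
      have hcol := g.col_lt
      rw [h1, pos_trans, pos_trans] at hcol
      -- Were this pair already inverted, the invariant on columns in the original `τ` would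
      -- contradict `hcol`. So the letter adds an inversion, and the new pair satisfies the
      -- invariant by `hcol` itself.
      have hlt : (wordPerm w').symm (lo i) < (wordPerm w').symm (hi i) := by
        rcases lt_or_gt_of_ne ((wordPerm w').symm.injective.ne (lo_ne_hi i)) with h | h
        · exact h
        · refine absurd (h4 _ (mem_permInv.2 ⟨h, ?_⟩)) hcol.not_gt
          simp [lo, hi, Fin.lt_def]
      refine ⟨i :: w', ?_, ?_, ?_, ?_⟩
      · rw [h1, wordPerm_cons]
        rfl
      · rw [wordPerm_cons, card_permInv_swap_mul _ _ hlt, List.length_cons, h2]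
      · rw [List.map_cons, List.prod_cons, Module.End.mul_apply, h3, skewFlip_of_flippable g]
      · rw [wordPerm_cons, permInv_swap_mul _ _ hlt]
        intro p hp
        rcases Finset.mem_insert.1 hp with rfl | hp
        · exact hcol
        · exact h4 p hp

/-- Frees the relation from reducedness: reflexivity comes from the empty word and transitivity from
concatenation. -/
theorem flipLE_of_word {τ τ' : SkewSRCT α β m} (w : List (Fin (m - 1)))
    (h : (w.map (skewFlip α β)).prod (Finsupp.single τ.1 1) = Finsupp.single τ'.1 1) :
    flipLE τ τ' := by
  obtain ⟨w', -, h2, h3, -⟩ := exists_reduced_of_flips _ _ w h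
  exact ⟨_, w', isReducedWord_of_length h2, h3⟩

theorem flipLE_refl (τ : SkewSRCT α β m) : flipLE τ τ := flipLE_of_word [] rfl

theorem flipLE_trans {τ₁ τ₂ τ₃ : SkewSRCT α β m} (h : flipLE τ₁ τ₂) (h' : flipLE τ₂ τ₃) :
    flipLE τ₁ τ₃ := by
  obtain ⟨-, w, -, h⟩ := h
  obtain ⟨-, w', -, h'⟩ := h'
  refine flipLE_of_word (w' ++ w) ?_
  rw [List.map_append, List.prod_append, Module.End.mul_apply, h, h']

/-- The sum of all entries, weighted by their columns. -/
def SkewFilling.weight (τ : SkewFilling α β m) : ℕ := ∑ x : Fin m, (x : ℕ) * (τ.pos x).2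

/-- The larger entry moves to the smaller column. As the entries differ by one, the weight drops by
the difference of the columns. -/
theorem weight_swapEntries_lt {τ : SkewFilling α β m} {i : Fin (m - 1)} (h : τ.Flippable i) :
    (τ.swapEntries i).weight < τ.weight := by
  have hcol := h.col_lt
  have hne : (hi i : Fin m) ∈ Finset.univ.erase (lo i) := by simp [(lo_ne_hi i).symm]
  simp only [weight]
  rw [← Finset.add_sum_erase _ _ (Finset.mem_univ (lo i)),
    ← Finset.add_sum_erase _ _ (Finset.mem_univ (lo i)), ← Finset.add_sum_erase _ _ hne,
    ← Finset.add_sum_erase _ _ hne, pos_swapEntries_lo, pos_swapEntries_hi,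
    Finset.sum_congr rfl fun x hx => by
      simp only [Finset.mem_erase] at hx
      rw [pos_swapEntries_of_ne τ i hx.2.1 hx.1]]
  simp only [lo, hi] at hcol ⊢
  nlinarith

theorem weight_lt_or_eq_of_flips {τ τ' : SkewFilling α β m} (w : List (Fin (m - 1)))
    (h : (w.map (skewFlip α β)).prod (Finsupp.single τ 1) = Finsupp.single τ' 1) :
    τ'.weight < τ.weight ∨ τ' = τ := by
  induction w generalizing τ' with
  | nil => exact Or.inr (single_one_injective h).symm
  | cons i w ih =>
    obtain ⟨τ₀, h₀, rfl | ⟨g, rfl⟩⟩ := exists_of_flips_cons h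
    · exact ih h₀
    · have := weight_swapEntries_lt g
      rcases ih h₀ with h' | rfl
      · exact Or.inl (this.trans h')
      · exact Or.inl this

theorem flipLE_antisymm {τ₁ τ₂ : SkewSRCT α β m} (h : flipLE τ₁ τ₂) (h' : flipLE τ₂ τ₁) :
    τ₁ = τ₂ := by
  obtain ⟨-, w, -, h⟩ := h
  obtain ⟨-, w', -, h'⟩ := h'
  rcases weight_lt_or_eq_of_flips w h with g | g
  · rcases weight_lt_or_eq_of_flips w' h' with g' | g'
    · omega
    · exact Subtype.ext g'
  · exact Subtype.ext g.symm

end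

section

open SkewFilling

/-! ### The quasisymmetric characteristic of a module with triangular action -/

/-- Traces are additive on extensions, so the right side descends to the Grothendieck group. On the
one-dimensional modules `heckeProj` acts by 0 or 1 and singles out one of them; uniqueness of the
characteristic map concludes. -/
theorem quasiChar_cls {n : ℕ} (M : HeckeRep n) :
    quasiChar M.cls = ∑ γ : Composition n,
      LinearMap.trace ℂ _ (M.ρ (heckeProj (compSetEquiv n γ))) • fundamentalQSym γ := by
  let c : ∀ n, HeckeG0 n →+ QSym := fun n => QuotientAddGroup.lift _
    (FreeAbelianGroup.lift fun M => ∑ γ : Composition n,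
      LinearMap.trace ℂ _ (M.ρ (heckeProj (compSetEquiv n γ))) • fundamentalQSym γ) (by
    rw [AddSubgroup.closure_le]
    rintro _ ⟨M', M, M'', h, rfl⟩
    simp [AddMonoidHom.mem_ker, h.trace, add_smul, Finset.sum_add_distrib])
  have hc : ∀ {n : ℕ} (M : HeckeRep n), DirectSum.toAddMonoid c M.cls = ∑ γ : Composition n,
      LinearMap.trace ℂ _ (M.ρ (heckeProj (compSetEquiv n γ))) • fundamentalQSym γ := by
    intro n M
    rw [HeckeRep.cls, DirectSum.toAddMonoid_of]
    simp [c]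
  have h : quasiChar = DirectSum.toAddMonoid c := by
    refine existsUnique_quasiChar.unique (fun n γ => quasiChar_irrRep γ) fun n γ => ?_
    rw [hc, Finset.sum_eq_single γ]
    · rw [irrRep_trace, heckeChar_heckeProj, if_pos rfl, one_smul]
    · intro δ _ hδ
      rw [irrRep_trace, heckeChar_heckeProj, if_neg ((compSetEquiv n).injective.ne hδ), zero_smul]
    · simp
  rw [h, hc]

/-! ### Triangular matrices and traces -/

/-- The matrix `A` has diagonal `d`, and its other nonzero entries decrease the weight `Φ`. -/
def IsTriangular {ι : Type*} (Φ : ι → ℕ) (A : Matrix ι ι ℂ) (d : ι → ℂ) : Prop :=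
  (∀ x, A x x = d x) ∧ ∀ x y, A x y ≠ 0 → x = y ∨ Φ x < Φ y

theorem IsTriangular.one {ι : Type*} [DecidableEq ι] (Φ : ι → ℕ) :
    IsTriangular Φ (1 : Matrix ι ι ℂ) 1 := by
  refine ⟨by simp, fun x y h => ?_⟩
  by_contra hc
  exact h (Matrix.one_apply_ne fun h' => hc (Or.inl h'))

theorem IsTriangular.sub {ι : Type*} {Φ : ι → ℕ} {A B : Matrix ι ι ℂ} {d e : ι → ℂ}
    (hA : IsTriangular Φ A d) (hB : IsTriangular Φ B e) : IsTriangular Φ (A - B) (d - e) := by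
  refine ⟨fun x => by simp [hA.1, hB.1], fun x y h => ?_⟩
  by_cases hxy : A x y = 0
  · refine hB.2 x y fun h' => h ?_
    simp [hxy, h']
  · exact hA.2 x y hxy

/-- A diagonal entry of the product gets no contribution through `z ≠ x`, as that would force `Φ x <
Φ z < Φ x`. -/
theorem IsTriangular.mul {ι : Type*} [Fintype ι] {Φ : ι → ℕ} {A B : Matrix ι ι ℂ} {d e : ι → ℂ}
    (hA : IsTriangular Φ A d) (hB : IsTriangular Φ B e) : IsTriangular Φ (A * B) (d * e) := by
  refine ⟨fun x => ?_, fun x y h => ?_⟩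
  · rw [Matrix.mul_apply, Finset.sum_eq_single x]
    · rw [hA.1, hB.1, Pi.mul_apply]
    · intro z _ hz
      by_contra hc
      have h1 := (hA.2 x z (left_ne_zero_of_mul hc)).resolve_left hz.symm
      have h2 := (hB.2 z x (right_ne_zero_of_mul hc)).resolve_left hz
      omega
    · simp
  · rw [Matrix.mul_apply] at h
    obtain ⟨z, -, hz⟩ := Finset.exists_ne_zero_of_sum_ne_zero h
    rcases hA.2 x z (left_ne_zero_of_mul hz) with rfl | h1
    · exact hB.2 _ y (right_ne_zero_of_mul hz)
    · rcases hB.2 z y (right_ne_zero_of_mul hz) with rfl | h2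
      · exact Or.inr h1
      · exact Or.inr (h1.trans h2)

/-- The characteristic of a module on which the generators act by triangular matrices with
diagonal entries `0` and `1`. -/
theorem quasiChar_of_triangular {n : ℕ} (M : HeckeRep n) {ι : Type*} [Fintype ι]
    [DecidableEq ι] (v : Module.Basis ι ℂ M.carrier) (Φ : ι → ℕ) (D : ι → Finset (Fin (n - 1)))
    (h : ∀ i, IsTriangular Φ (LinearMap.toMatrix v v (M.ρ (HeckeZero.T i)))
      fun x => if i ∈ D x then 0 else 1) :
    quasiChar M.cls = ∑ x, fundamentalQSym ((compSetEquiv n).symm (D x)) := by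
  have key : ∀ J : Finset (Fin (n - 1)), IsTriangular Φ
      (LinearMap.toMatrix v v (M.ρ (heckeProj J))) fun x => if D x = J then 1 else 0 := by
    intro J
    -- Each factor has as diagonal the indicator that `D x` and `J` agree at `i`. The product over
    -- all `i` is the indicator of `D x = J`.
    have hl : ∀ l : List (Fin (n - 1)), IsTriangular Φ (LinearMap.toMatrix v v
        (M.ρ (l.map fun i => if i ∈ J then 1 - HeckeZero.T i else HeckeZero.T i).prod))
        fun x => if ∀ i ∈ l, i ∈ D x ↔ i ∈ J then 1 else 0 := by
      intro l
      induction l with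
      | nil =>
        simp only [List.map_nil, List.prod_nil, map_one, LinearMap.toMatrix_one]
        convert IsTriangular.one Φ using 1
        ext x
        simp
      | cons i l ih =>
        rw [List.map_cons, List.prod_cons, map_mul, LinearMap.toMatrix_mul]
        have hi : IsTriangular Φ (LinearMap.toMatrix v v
            (M.ρ (if i ∈ J then 1 - HeckeZero.T i else HeckeZero.T i)))
            fun x => if i ∈ D x ↔ i ∈ J then 1 else 0 := by
          by_cases hJ : i ∈ J
          · rw [if_pos hJ, map_sub, map_one, map_sub, LinearMap.toMatrix_one]
            convert (IsTriangular.one Φ).sub (h i) using 1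
            ext x
            by_cases hx : i ∈ D x <;> simp [hx, hJ]
          · rw [if_neg hJ]
            convert h i using 1
            ext x
            by_cases hx : i ∈ D x <;> simp [hx, hJ]
        convert hi.mul ih using 1
        ext x
        simp only [List.forall_mem_cons, Pi.mul_apply, ite_and, mul_ite, mul_one, mul_zero]
        split_ifs <;> simp
    simpa only [Finset.ext_iff, List.mem_finRange, true_imp_iff, forall_true_left, heckeProj]
      using hl (List.finRange (n - 1))
  rw [quasiChar_cls]
  have ht : ∀ γ : Composition n, LinearMap.trace ℂ _ (M.ρ (heckeProj (compSetEquiv n γ))) =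
      ∑ x, if D x = compSetEquiv n γ then 1 else 0 := by
    intro γ
    rw [LinearMap.trace_eq_matrix_trace ℂ v, Matrix.trace]
    exact Finset.sum_congr rfl fun x _ => (key _).1 x
  simp only [ht, Finset.sum_smul, ite_smul, one_smul, zero_smul]
  rw [Finset.sum_comm]
  refine Finset.sum_congr rfl fun x _ => ?_
  simp only [← Equiv.symm_apply_eq]
  rw [Finset.sum_ite_eq, if_pos (Finset.mem_univ _)]

/-! ### The module spanned by the tableaux -/

variable {a b m : ℕ} {α : Composition a} {β : Composition b}

/-- The action of the `0`-Hecke algebra on the space spanned by all fillings. -/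
noncomputable def fillingRep (α : Composition a) (β : Composition b) (m : ℕ) :
    HeckeZero m →ₐ[ℂ] Module.End ℂ (SkewFilling α β m →₀ ℂ) :=
  RingQuot.liftAlgHom ℂ ⟨FreeAlgebra.lift ℂ (skewFlip α β), by
    rintro _ _ (i | ⟨i, j, h⟩ | ⟨i, j, h⟩) <;> simp only [map_mul, FreeAlgebra.lift_ι_apply]
    · exact skewFlip_idem i
    · exact skewFlip_braid i j h
    · exact skewFlip_comm i j h⟩

theorem fillingRep_T (i : Fin (m - 1)) : fillingRep α β m (HeckeZero.T i) = skewFlip α β i := by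
  simp [fillingRep, HeckeZero.T]

/-- By `h` the span contains every tableau, so it suffices that a flip of a tableau is zero or a
tableau. -/
theorem skewFlip_mem_upperSpan {le : SkewSRCT α β m → SkewSRCT α β m → Prop}
    {τ₁ : SkewSRCT α β m} (h : ∀ τ, le τ₁ τ) (i : Fin (m - 1)) {v : SkewFilling α β m →₀ ℂ}
    (hv : v ∈ upperSpan le τ₁) : skewFlip α β i v ∈ upperSpan le τ₁ := by
  revert v
  change upperSpan le τ₁ ≤ (upperSpan le τ₁).comap (skewFlip α β i)
  refine Submodule.span_le.2 ?_
  rintro _ ⟨τ, -, rfl⟩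
  rw [SetLike.mem_coe, Submodule.mem_comap]
  rcases flip_cases τ.1 i with g | g | g
  · rw [skewFlip_of_notMem g]
    exact Submodule.subset_span ⟨τ, h τ, rfl⟩
  · rw [skewFlip_of_attacking g.1 g.2]
    exact zero_mem _
  · rw [skewFlip_of_flippable g]
    exact Submodule.subset_span ⟨⟨_, τ.2.swapEntries g⟩, h _, rfl⟩

theorem fillingRep_mem_upperSpan {le : SkewSRCT α β m → SkewSRCT α β m → Prop}
    {τ₁ : SkewSRCT α β m} (h : ∀ τ, le τ₁ τ) (x : HeckeZero m) :
    ∀ v ∈ upperSpan le τ₁, fillingRep α β m x v ∈ upperSpan le τ₁ := by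
  induction x using HeckeZero.induction with
  | h1 c =>
    intro v hv
    rw [AlgHom.commutes, Module.algebraMap_end_apply]
    exact Submodule.smul_mem _ _ hv
  | h2 i =>
    intro v hv
    rw [fillingRep_T]
    exact skewFlip_mem_upperSpan h i hv
  | h3 x y hx hy =>
    intro v hv
    rw [map_mul]
    exact hx _ (hy _ hv)
  | h4 x y hx hy =>
    intro v hv
    rw [map_add]
    exact add_mem (hx _ hv) (hy _ hv)

/-- The action of the `0`-Hecke algebra on the space spanned by all tableaux. -/
noncomputable def upperSpanRep {le : SkewSRCT α β m → SkewSRCT α β m → Prop}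
    {τ₁ : SkewSRCT α β m} (h : ∀ τ, le τ₁ τ) :
    HeckeZero m →ₐ[ℂ] Module.End ℂ (upperSpan le τ₁) :=
  AlgHom.ofLinearMap
    { toFun := fun x => (fillingRep α β m x).restrict (fillingRep_mem_upperSpan h x)
      map_add' := fun x y => by ext; simp
      map_smul' := fun c x => by ext; simp }
    (by ext; simp) (fun x y => by ext; simp)

theorem upperSpanRep_T {le : SkewSRCT α β m → SkewSRCT α β m → Prop}
    {τ₁ : SkewSRCT α β m} (h : ∀ τ, le τ₁ τ) (i : Fin (m - 1)) (v : upperSpan le τ₁) :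
    (upperSpanRep h (HeckeZero.T i) v : SkewFilling α β m →₀ ℂ) = skewFlip α β i v := by
  rw [← fillingRep_T]
  rfl

/-- The basis of tableaux. -/
noncomputable def upperSpanBasis {le : SkewSRCT α β m → SkewSRCT α β m → Prop}
    {τ₁ : SkewSRCT α β m} (h : ∀ τ, le τ₁ τ) :
    Module.Basis (SkewSRCT α β m) ℂ (upperSpan le τ₁) :=
  Module.Basis.mk (v := fun τ => ⟨Finsupp.single τ.1 1, Submodule.subset_span ⟨τ, h τ, rfl⟩⟩)
    (LinearIndependent.of_comp (upperSpan le τ₁).subtype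
      ((Finsupp.linearIndependent_single_one ℂ (SkewFilling α β m)).comp _
        Subtype.val_injective))
    (by
      rintro ⟨v, hv⟩ -
      induction hv using Submodule.span_induction with
      | mem v hv =>
        obtain ⟨τ, -, rfl⟩ := hv
        exact Submodule.subset_span ⟨τ, rfl⟩
      | zero => exact zero_mem _
      | add v w hv hw hv' hw' => exact add_mem hv' hw'
      | smul c v hv hv' => exact Submodule.smul_mem _ c hv')

theorem upperSpanBasis_coe {le : SkewSRCT α β m → SkewSRCT α β m → Prop}
    {τ₁ : SkewSRCT α β m} (h : ∀ τ, le τ₁ τ) (τ : SkewSRCT α β m) :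
    (upperSpanBasis h τ : SkewFilling α β m →₀ ℂ) = Finsupp.single τ.1 1 := by
  rw [upperSpanBasis, Module.Basis.mk_apply]

/-- At a non-descent the basis vector is fixed. At a descent its image is zero or a basis vector of
strictly smaller weight, so the diagonal entry vanishes. -/
theorem isTriangular_upperSpanRep [Fintype (SkewSRCT α β m)]
    [DecidableEq (SkewSRCT α β m)] {le : SkewSRCT α β m → SkewSRCT α β m → Prop}
    {τ₁ : SkewSRCT α β m} (h : ∀ τ, le τ₁ τ) (i : Fin (m - 1)) :
    IsTriangular (fun τ : SkewSRCT α β m => τ.1.weight)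
      (LinearMap.toMatrix (upperSpanBasis h) (upperSpanBasis h) (upperSpanRep h (HeckeZero.T i)))
      fun τ => if i ∈ τ.1.descents then 0 else 1 := by
  have key : ∀ τ : SkewSRCT α β m,
      (i ∉ τ.1.descents ∧ upperSpanRep h (HeckeZero.T i) (upperSpanBasis h τ) =
        upperSpanBasis h τ) ∨
      (i ∈ τ.1.descents ∧ (upperSpanRep h (HeckeZero.T i) (upperSpanBasis h τ) = 0 ∨
        ∃ τ' : SkewSRCT α β m, τ'.1.weight < τ.1.weight ∧
          upperSpanRep h (HeckeZero.T i) (upperSpanBasis h τ) = upperSpanBasis h τ')) := by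
    intro τ
    rcases flip_cases τ.1 i with g | g | g
    · refine Or.inl ⟨g, Subtype.ext ?_⟩
      rw [upperSpanRep_T, upperSpanBasis_coe, skewFlip_of_notMem g]
    · refine Or.inr ⟨g.1, Or.inl (Subtype.ext ?_)⟩
      rw [upperSpanRep_T, upperSpanBasis_coe, skewFlip_of_attacking g.1 g.2]
      rfl
    · refine Or.inr ⟨g.1, Or.inr ⟨⟨_, τ.2.swapEntries g⟩, weight_swapEntries_lt g,
        Subtype.ext ?_⟩⟩
      rw [upperSpanRep_T, upperSpanBasis_coe, upperSpanBasis_coe, skewFlip_of_flippable g]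
  refine ⟨fun τ => ?_, fun τ' τ hne => ?_⟩
  · rw [LinearMap.toMatrix_apply]
    beta_reduce
    rcases key τ with ⟨g, e⟩ | ⟨g, e | ⟨τ', hw, e⟩⟩
    · rw [e, if_neg g, Module.Basis.repr_self, Finsupp.single_eq_same]
    · rw [e, if_pos g, map_zero, Finsupp.zero_apply]
    · rw [e, if_pos g, Module.Basis.repr_self, Finsupp.single_eq_of_ne]
      rintro rfl
      exact lt_irrefl _ hw
  · rw [LinearMap.toMatrix_apply] at hne
    rcases key τ with ⟨g, e⟩ | ⟨g, e | ⟨τ'', hw, e⟩⟩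
    · rw [e, Module.Basis.repr_self] at hne
      exact Or.inl (by_contra fun hc => hne (Finsupp.single_eq_of_ne hc))
    · rw [e, map_zero] at hne
      exact absurd rfl hne
    · rw [e, Module.Basis.repr_self] at hne
      obtain rfl : τ' = τ'' := by_contra fun hc => hne (Finsupp.single_eq_of_ne hc)
      exact Or.inr hw

theorem quasiChar_upperSpanRep_eq_sum [Fintype (SkewSRCT α β m)] [DecidableEq (SkewSRCT α β m)]
    {le : SkewSRCT α β m → SkewSRCT α β m → Prop} {τ₁ : SkewSRCT α β m} (h : ∀ τ, le τ₁ τ) :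
    quasiChar (HeckeRep.cls ⟨upperSpan le τ₁, upperSpanRep h⟩) =
      ∑ τ : SkewSRCT α β m, fundamentalQSym τ.1.descentComp := by
  let M : HeckeRep m := ⟨upperSpan le τ₁, upperSpanRep h⟩
  let v : Module.Basis (SkewSRCT α β m) ℂ M.carrier := upperSpanBasis h
  refine quasiChar_of_triangular M v
    (fun τ => τ.1.weight) (fun τ => τ.1.descents) fun i => isTriangular_upperSpanRep h i
/-- The characteristic of the module of tableaux is the skew quasisymmetric Schur function. -/
theorem quasiChar_upperSpanRep {le : SkewSRCT α β m → SkewSRCT α β m → Prop}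
    {τ₁ : SkewSRCT α β m} (h : ∀ τ, le τ₁ τ) :
    ((quasiChar (HeckeRep.cls ⟨upperSpan le τ₁, upperSpanRep h⟩) : QSym) : MvPowerSeries ℕ ℂ) =
      skewQuasiSchur α β m := by
  classical
  have key := congrArg Subtype.val (quasiChar_upperSpanRep_eq_sum h)
  refine key.trans ?_
  rw [AddSubmonoidClass.coe_finsetSum, skewQuasiSchur]
  exact Finset.sum_congr (by congr) fun _ _ => rfl

end

theorem theorem9p7 {a b m : ℕ} (α : Composition a) (β : Composition b)
    (hlt : RCLT β α) (hm : b + m = a) :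
    -- the set of tableaux is nonempty and partially ordered by `≼`
    Nonempty (SkewSRCT α β m) ∧
    (∀ τ : SkewSRCT α β m, flipLE τ τ) ∧
    (∀ τ₁ τ₂ τ₃ : SkewSRCT α β m, flipLE τ₁ τ₂ → flipLE τ₂ τ₃ → flipLE τ₁ τ₃) ∧
    (∀ τ₁ τ₂ : SkewSRCT α β m, flipLE τ₁ τ₂ → flipLE τ₂ τ₁ → τ₁ = τ₂) ∧
    -- for each extension to a total order, with minimal element `τ₁`
    ∀ t : LinearOrder (SkewSRCT α β m), (∀ τ τ' : SkewSRCT α β m, flipLE τ τ' → t.le τ τ') →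
    ∀ τ₁ : SkewSRCT α β m, (∀ τ : SkewSRCT α β m, t.le τ₁ τ) →
      ∃ ρ : HeckeZero m →ₐ[ℂ] Module.End ℂ (upperSpan t.le τ₁),
        (∀ (i : Fin (m - 1)) (v : upperSpan t.le τ₁),
          (ρ (HeckeZero.T i) v : SkewFilling α β m →₀ ℂ) = skewFlip α β i v) ∧
        ((quasiChar (HeckeRep.cls ⟨upperSpan t.le τ₁, ρ⟩) : QSym) : MvPowerSeries ℕ ℂ) =
          skewQuasiSchur α β m := by
  refine ⟨SkewSRCT.nonempty hlt hm, flipLE_refl, fun _ _ _ => flipLE_trans,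
    fun _ _ => flipLE_antisymm, fun t _ τ₁ h => ⟨upperSpanRep h, upperSpanRep_T h,
      quasiChar_upperSpanRep h⟩⟩
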